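/- **Theorem.** Let $n\ge 2$, $0\le\theta<1$. *Kernels.* A majorizing kernel with exponent $\theta\ge 0$ on $\mathbf R^n$ is a function $h:\mathbf R^n\to(0,\infty]$, finite almost everywhere, that is locally integrable and defines a tempered distribution, and for which there is $B>0$ with $$h*h(\xi)=\int_{\mathbf R^n}h(\xi-\eta)h(\eta)\,d\eta\le B|\xi|^\theta h(\xi)\qquad(\xi\in\mathbf R^n),$$ where the right-hand side is read as $\infty$ wherever $h(\xi)=\infty$. For $\alpha\ge0$, $\omega>0$ let $\mathcal H^\theta_{\alpha,\omega}(\mathbf R^n)$ be the set of majorizing kernels $h$ with exponent $\theta$ such that (1) $h(\xi)=O(|\xi|^{-\alpha})$ and $|\xi|^{-\alpha}=O(h(\xi))$ as $\xi\to0$; (2) $h(\xi)=O(|\xi|^{-\omega})$ and $|\xi|^{-\omega}=O(h(\xi))$ as $\xi\to\infty$; (3) $h$ is bounded on the complement of every neighborhood of the origin. *Spaces.* Fix $m\ge 0$. With $\hat f(\xi)=(2\pi)^{-n/2}\int e^{-ix\cdot\xi}f(x)\,dx$ (extended to tempered distributions), let $$\mathcal F_h=\Big\{f\in\mathcal S'(\mathbf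 R^n)^m:\ \hat f\in L^1_{\rm loc}(\mathbf R^n)^m,\ \|f\|_{\mathcal F_h}=\operatorname*{ess\,sup}_{\xi\in\mathbf R^n}\frac{|\hat f(\xi)|}{h(\xi)}<\infty\Big\}.$$ For $f\in\mathcal S'(\mathbf R^n)^m$ and $T>0$ let $$\|f\|_{BMO_T^{-1}}=\sup_{x\in\mathbf R^n,\ 0<R^2<T}\Big(\frac1{|B(x,R)|}\int_0^{R^2}\int_{B(x,R)}|e^{t\Delta}f(y)|^2\,dy\,dt\Big)^{1/2},$$ where $e^{t\Delta}$ is the heat semigroup, let $BMO_T^{-1}$ be the space of $f$ with $\|f\|_{BMO_T^{-1}}<\infty$, and let $\overline{VMO}{}^{-1}=\{f\in BMO_1^{-1}:\|f\|_{BMO_T^{-1}}\to0\text{ as }T\to0\}$, normed by $\|\cdot\|_{BMO_1^{-1}}$. *Claim.* Let $h\in\mathcal H^\theta_{\alpha,\omega}(\mathbf R^n)$. (a) If $0<\theta<1$, there is a constant $C$ such that for all $f\in\mathcal F_h$ and all $T>0$ $$\|f\|_{BMO_T^{-1}}\le C\,T^{(1-\theta)/2}\,\|f\|_{\mathcal F_h},$$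 and $\mathcal F_h$ is continuously embedded in $\overline{VMO}{}^{-1}$. (b) If $\theta=0$, there is a constant $C$ such that for all $f\in\mathcal F_h$ and all $T>0$ $$\|f\|_{BMO_T^{-1}}\le\begin{cases}C\,T^{1/2}\,\|f\|_{\mathcal F_h}&\text{if }\omega>n,\\ C\,T^{1/2}\,(1+\log_+T^{-1/2})^{1/2}\,\|f\|_{\mathcal F_h}&\text{if }\omega=n,\end{cases}$$ where $\log_+x=\max\{\log x,0\}$, and $\mathcal F_h$ is continuously embedded in $\overline{VMO}{}^{-1}$ (for every $\omega$ for which the hypothesis holds). -/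

import Mathlib

open MeasureTheory Filter Topology Set
open scoped ENNReal NNReal SchwartzMap FourierTransform

noncomputable section

namespace MajorizingKernels

/-- `ℝⁿ` with its Euclidean norm. -/
abbrev Rn (n : ℕ) := EuclideanSpace ℝ (Fin n)

/-! ### Tempered distributions that are functions, and the Fourier transform -/

/-- The tempered distribution `u` is the locally integrable function `g`: both agree on all smooth
compactly supported test functions. -/
def IsFunction {n : ℕ} {F : Type*} [NormedAddCommGroup F] [NormedSpace ℂ F]
    (u : 𝓢'(Rn n, F)) (g : Rn n → F) : Prop :=
  LocallyIntegrable g volume ∧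
    ∀ φ : 𝓢(Rn n, ℂ), HasCompactSupport φ → u φ = ∫ ξ, φ ξ • g ξ

/-- `f̂ ∈ L¹_loc` and `f̂ = g`, for the Fourier transform normalized as
`f̂(ξ) = (2π)^{-n/2} ∫ e^{-i x·ξ} f(x) dx`. Mathlib's transform
`𝓕 f (ζ) = ∫ e^{-2πi x·ζ} f(x) dx` equals `(2π)^{n/2} f̂(2πζ)`. -/
def HasFourierFunction {n : ℕ} {F : Type*} [NormedAddCommGroup F] [NormedSpace ℂ F]
    (f : 𝓢'(Rn n, F)) (g : Rn n → F) : Prop :=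
  IsFunction (𝓕 f)
    (fun ζ => (((2 * Real.pi) ^ ((n : ℝ) / 2) : ℝ) : ℂ) • g ((2 * Real.pi) • ζ))

/-! ### Majorizing kernels -/

/-- The convolution `h * h (ξ) = ∫ h(ξ - η) h(η) dη ∈ [0, ∞]`. -/
def selfConv {n : ℕ} (h : Rn n → ℝ≥0∞) (ξ : Rn n) : ℝ≥0∞ :=
  ∫⁻ η, h (ξ - η) * h η

/-- `h ∈ ℋ^θ(ℝⁿ)`: `h` is a majorizing kernel with exponent `θ`. -/
structure IsMajorizingKernel {n : ℕ} (θ : ℝ) (h : Rn n → ℝ≥0∞) : Prop where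
  exponent_nonneg : 0 ≤ θ
  aemeasurable : AEMeasurable h volume
  /-- `h` takes values in `(0, ∞]`. -/
  pos : ∀ ξ, 0 < h ξ
  /-- `h` is finite almost everywhere. -/
  finite_ae : volume {ξ | h ξ = ∞} = 0
  /-- `h` is a tempered distribution that is also a function. -/
  tempered : ∃ u : 𝓢'(Rn n, ℂ), IsFunction u (fun ξ => ((h ξ).toReal : ℂ))
  /-- `h * h (ξ) ≤ B |ξ|^θ h(ξ)` for all `ξ`, where the right-hand side is read as `∞` at the points
  with `h(ξ) = ∞` (also at `ξ = 0`, where Lean's `0 * ∞` would be `0`). -/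
  conv_le : ∃ B : ℝ, 0 < B ∧
    ∀ ξ, h ξ ≠ ∞ → selfConv h ξ ≤ ENNReal.ofReal (B * ‖ξ‖ ^ θ) * h ξ

/-- `h(ξ) = O(|ξ|^{-a})` and `|ξ|^{-a} = O(h(ξ))` along the filter `l`. -/
def BehavesAlong {n : ℕ} (l : Filter (Rn n)) (a : ℝ) (h : Rn n → ℝ≥0∞) : Prop :=
  (∃ C : ℝ≥0, ∀ᶠ ξ in l, h ξ ≤ C * ENNReal.ofReal (‖ξ‖ ^ (-a))) ∧
    (∃ C : ℝ≥0, ∀ᶠ ξ in l, ENNReal.ofReal (‖ξ‖ ^ (-a)) ≤ C * h ξ)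

/-- `h ∈ ℋ^θ_{α,ω}(ℝⁿ)`: a majorizing kernel with radial algebraic growth and decay. -/
structure IsRadialMajorizingKernel {n : ℕ} (θ α ω : ℝ) (h : Rn n → ℝ≥0∞) : Prop
    extends IsMajorizingKernel θ h where
  alpha_nonneg : 0 ≤ α
  omega_pos : 0 < ω
  at_origin : BehavesAlong (𝓝[≠] 0) α h
  at_infinity : BehavesAlong (Bornology.cobounded (Rn n)) ω h
  /-- `h` is bounded on the complement of any neighborhood of the origin. -/
  bounded_away : ∀ U ∈ 𝓝 (0 : Rn n), ∃ M : ℝ≥0, ∀ ξ ∉ U, h ξ ≤ M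

/-! ### The majorization space -/

/-- The norm `‖f‖_{ℱ_h} = sup_ξ |f̂(ξ)| / h(ξ)`. As `f̂` is a class of functions modulo null sets,
the supremum is the essential one. The function `f̂` is unique up to a null set if it exists, so the
infimum is over equal values; it is `∞` if `f̂` is not a locally integrable function. -/
def majNorm {n : ℕ} {F : Type*} [NormedAddCommGroup F] [NormedSpace ℂ F]
    (h : Rn n → ℝ≥0∞) (f : 𝓢'(Rn n, F)) : ℝ≥0∞ :=
  ⨅ (g : Rn n → F) (_ : HasFourierFunction f g),
    essSup (fun ξ => (h ξ)⁻¹ * ‖g ξ‖ₑ) volume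

/-- The majorization space `ℱ_h`. -/
def majSpace {n : ℕ} (F : Type*) [NormedAddCommGroup F] [NormedSpace ℂ F]
    (h : Rn n → ℝ≥0∞) : Set 𝓢'(Rn n, F) :=
  {f | ∃ g : Rn n → F, HasFourierFunction f g ∧
    essSup (fun ξ => (h ξ)⁻¹ * ‖g ξ‖ₑ) volume < ∞}

/-! ### The heat semigroup on tempered distributions -/

lemma one_add_pow_mul_exp_le {a : ℝ} (ha : 0 < a) (N : ℕ) {r : ℝ} (hr : 0 ≤ r) :
    (1 + r) ^ N * Real.exp (-a * r ^ 2) ≤ N.factorial * Real.exp (1 + 1 / (4 * a)) := by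
  have h1 : (1 + r) ^ N ≤ N.factorial * Real.exp (1 + r) := by
    have := Real.pow_div_factorial_le_exp (1 + r) (by linarith) N
    rw [div_le_iff₀ (by positivity)] at this
    linarith
  have h2 : 1 + r + -a * r ^ 2 ≤ 1 + 1 / (4 * a) := by
    have h3 : 1 / (4 * a) - (r - a * r ^ 2) = (2 * a * r - 1) ^ 2 / (4 * a) := by
      field_simp
      ring
    have h4 : 0 ≤ (2 * a * r - 1) ^ 2 / (4 * a) := by positivity
    linarith
  calc (1 + r) ^ N * Real.exp (-a * r ^ 2)
      ≤ N.factorial * Real.exp (1 + r) * Real.exp (-a * r ^ 2) := by gcongr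
    _ = N.factorial * Real.exp (1 + r + -a * r ^ 2) := by rw [mul_assoc, ← Real.exp_add]
    _ ≤ _ := by gcongr

lemma gaussian_decay {n : ℕ} {a : ℝ} (ha : 0 < a) (k m : ℕ) :
    ∃ C : ℝ, ∀ x : Rn n,
      ‖x‖ ^ k * ‖iteratedFDeriv ℝ m (fun x : Rn n => Real.exp (-a * ‖x‖ ^ 2)) x‖ ≤ C := by
  obtain ⟨l, D, hD, hq⟩ :=
    (Function.hasTemperateGrowth_norm_sq (Rn n)).norm_iteratedFDeriv_le_uniform m
  refine ⟨m.factorial * (1 + a) ^ m * (1 + D) ^ m *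
    ((k + l * m).factorial * Real.exp (1 + 1 / (4 * a))), fun x => ?_⟩
  have hg : ContDiff ℝ m (fun s : ℝ => Real.exp (-a * s)) := by fun_prop
  have hf : ContDiff ℝ m (fun x : Rn n => ‖x‖ ^ 2) := contDiff_norm_sq ℝ
  have hx : 1 ≤ 1 + ‖x‖ := by linarith [norm_nonneg x]
  have key := norm_iteratedFDeriv_comp_le (n := m) hg hf le_rfl x
    (C := (1 + a) ^ m * Real.exp (-a * ‖x‖ ^ 2)) (D := (1 + D) * (1 + ‖x‖) ^ l)
    (fun i hi => by
      rw [norm_iteratedFDeriv_eq_norm_iteratedDeriv, iteratedDeriv_exp_const_mul, norm_mul,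
        norm_pow, norm_neg, Real.norm_of_nonneg ha.le, Real.norm_of_nonneg (Real.exp_nonneg _)]
      gcongr
      calc a ^ i ≤ (1 + a) ^ i := by gcongr; linarith
        _ ≤ (1 + a) ^ m := pow_le_pow_right₀ (by linarith) hi)
    (fun i hi hi' => by
      have h1 : 1 ≤ (1 + D) * (1 + ‖x‖) ^ l :=
        one_le_mul_of_one_le_of_one_le (by linarith) (one_le_pow₀ hx)
      calc _ ≤ D * (1 + ‖x‖) ^ l := hq i hi' x
        _ ≤ (1 + D) * (1 + ‖x‖) ^ l := by gcongr; linarith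
        _ ≤ _ := le_self_pow₀ h1 (by omega))
  calc ‖x‖ ^ k * ‖iteratedFDeriv ℝ m (fun x : Rn n => Real.exp (-a * ‖x‖ ^ 2)) x‖
      ≤ (1 + ‖x‖) ^ k * (m.factorial * ((1 + a) ^ m * Real.exp (-a * ‖x‖ ^ 2)) *
          ((1 + D) * (1 + ‖x‖) ^ l) ^ m) := by
        gcongr
        · linarith
        · exact key
    _ = m.factorial * (1 + a) ^ m * (1 + D) ^ m *
          ((1 + ‖x‖) ^ (k + l * m) * Real.exp (-a * ‖x‖ ^ 2)) := by
        rw [mul_pow, ← pow_mul, pow_add]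
        ring
    _ ≤ _ := by
        exact mul_le_mul_of_nonneg_left (one_add_pow_mul_exp_le ha _ (norm_nonneg x))
          (by positivity)

/-- The Gaussian `x ↦ exp(-a |x|²)`, `a > 0`, as a Schwartz function. -/
def gaussian (n : ℕ) (a : ℝ) (ha : 0 < a) : 𝓢(Rn n, ℝ) where
  toFun x := Real.exp (-a * ‖x‖ ^ 2)
  smooth' := Real.contDiff_exp.comp (contDiff_const.mul (contDiff_norm_sq ℝ))
  decay' := gaussian_decay ha

/-- The heat kernel `x ↦ (4πt)^{-n/2} exp(-|x|²/(4t))`, `t > 0`, as a Schwartz function. -/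
def heatKernel (n : ℕ) (t : ℝ) (ht : 0 < t) : 𝓢(Rn n, ℂ) :=
  (((4 * Real.pi * t) ^ (-(n : ℝ) / 2) : ℝ) : ℂ) •
    (gaussian n (1 / (4 * t)) (by positivity)).postcompCLM Complex.ofRealCLM

lemma heatKernel_apply (n : ℕ) (t : ℝ) (ht : 0 < t) (x : Rn n) :
    heatKernel n t ht x =
      (((4 * Real.pi * t) ^ (-(n : ℝ) / 2) * Real.exp (-‖x‖ ^ 2 / (4 * t)) : ℝ) : ℂ) := by
  have : heatKernel n t ht x = (((4 * Real.pi * t) ^ (-(n : ℝ) / 2) : ℝ) : ℂ) *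
      ((Real.exp (-(1 / (4 * t)) * ‖x‖ ^ 2) : ℝ) : ℂ) := rfl
  rw [this, ← Complex.ofReal_mul]
  congr 3
  ring

/-- The heat semigroup: `(e^{tΔ} f)(y)` for `t > 0`, i.e. the distribution `f` applied to
`z ↦ heatKernel t (z - y)` (the heat kernel is even). The value for `t ≤ 0` is never used. -/
def heat {n : ℕ} {F : Type*} [NormedAddCommGroup F] [NormedSpace ℂ F]
    (t : ℝ) (f : 𝓢'(Rn n, F)) (y : Rn n) : F :=
  if ht : 0 < t then f (SchwartzMap.compSubConstCLM ℂ y (heatKernel n t ht)) else 0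

/-! ### The spaces `BMO_T^{-1}` and `VMO-bar^{-1}` -/

/-- `‖f‖_{BMO_T^{-1}}`, the supremum over all `x` and all `0 < R` with `R² < T` of
`(|B(x,R)|⁻¹ ∫_0^{R²} ∫_{B(x,R)} |e^{tΔ} f(y)|² dy dt)^{1/2}`. -/
def bmoNorm {n : ℕ} {F : Type*} [NormedAddCommGroup F] [NormedSpace ℂ F]
    (T : ℝ) (f : 𝓢'(Rn n, F)) : ℝ≥0∞ :=
  ⨆ (x : Rn n) (R : ℝ) (_ : 0 < R) (_ : R ^ 2 < T),
    ((volume (Metric.ball x R))⁻¹ *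
      ∫⁻ t in Ioo 0 (R ^ 2), ∫⁻ y in Metric.ball x R, ‖heat t f y‖ₑ ^ 2) ^ (1 / 2 : ℝ)

/-- `VMO-bar^{-1}`: the `f ∈ BMO_1^{-1}` with `‖f‖_{BMO_T^{-1}} → 0` as `T → 0`. Its norm is that of
`BMO_1^{-1}`. -/
def vmoSpace (n : ℕ) (F : Type*) [NormedAddCommGroup F] [NormedSpace ℂ F] :
    Set 𝓢'(Rn n, F) :=
  {f | bmoNorm 1 f < ∞ ∧ Tendsto (fun T : ℝ => bmoNorm T f) (𝓝[>] 0) (𝓝 0)}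

/-- The continuous embedding `X ↪ Y` of two normed spaces of tempered distributions: `X ⊆ Y`, and
the (linear) inclusion is bounded. -/
def ContinuouslyEmbeds {V : Type*} (X : Set V) (normX : V → ℝ≥0∞)
    (Y : Set V) (normY : V → ℝ≥0∞) : Prop :=
  X ⊆ Y ∧ ∃ C : ℝ≥0, ∀ f ∈ X, normY f ≤ C * normX f

end MajorizingKernels

end

open MajorizingKernels

/-! Let `M` be the majorization norm of `f`, so that `|f̂| ≤ M h` almost everywhere. The heat
extension `e^{tΔ}f` is the inverse Fourier transform of a Gaussian multiplier, at most 1, times `f̂`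
(`heat_eq_fourierInv`). To bound its mean square over `B(x,R)`, dominate the indicator of the ball
by `e^π exp(-π|y-x|²/R²)`, expand the square as a double frequency integral, and integrate in `y`
first. Taking absolute values afterwards leaves a constant times `M²` times the form `gaussForm h R
= ∬ h(ξ) h(η) exp(-R²|ξ-η|²/(4π)) dξ dη`, uniformly in `t` and `x`. The integral over `0 < t < R²`
then costs only a factor `R²`. Everything reduces to bounding `R² * gaussForm h R` for `R² < T`
(`exists_bmoNorm_le_of_gaussForm_le`).

Testing the convolution inequality at small and at large scales forces `α ≤ n - θ ≤ ω` (`alpha_le`,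
`le_omega`).

For `0 < θ < 1` it follows that `h` is dominated by `|ξ|^{θ-n}`. The form of this homogeneous
majorant is finite at `R = 1` (`gaussForm_rpow_one_lt_top`) and scales like `R^{-2θ}`
(`gaussForm_rpow`), so `R²` times it is of order `R^{2(1-θ)}`.

For `θ = 0` and `ω > n` the kernel is integrable and the form is at most `‖h‖₁²`. For `θ = 0` and `ω
= n`, the kernel is even up to a constant (`exists_neg_le`), so the form is controlled by `∫
(h*h)(ζ) exp(-R²|ζ|²/(4π)) dζ`; the inequality `h*h ≤ B h` leaves a single integral, whose tail
`|ζ|^{-n}` produces one factor `1 + log₊(1/R)`. Since `ω ≥ n` is automatic, these two cases exhaust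
`θ = 0`. All the rates tend to zero with `T`, which gives the embeddings. -/

noncomputable section

namespace MajorizingKernels

/-! ### Compactly supported functions are dense in the Schwartz space -/

section SchwartzDensity

open scoped ContDiff

/-- A smooth function with bounded derivatives that vanishes on the unit ball, dilated by `a → 0`,
multiplies Schwartz functions to zero. -/
lemma norm_pow_mul_iteratedFDeriv_smul_le {n : ℕ} {e : Rn n → ℝ} (he : ContDiff ℝ ∞ e)
    {D : ℕ → ℝ} (hD : ∀ i x, ‖iteratedFDeriv ℝ i e x‖ ≤ D i)
    (he0 : ∀ x, ‖x‖ < 1 → e x = 0) (ψ : 𝓢(Rn n, ℂ)) (k m : ℕ) {a : ℝ} (ha : 0 < a) (ha1 : a ≤ 1)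
    (x : Rn n) :
    ‖x‖ ^ k * ‖iteratedFDeriv ℝ m (fun y => e (a • y) • ψ y) x‖ ≤
      a * ∑ i ∈ Finset.range (m + 1),
        (m.choose i : ℝ) * D i * SchwartzMap.seminorm ℂ (k + 1) (m - i) ψ := by
  have hD0 : ∀ i, 0 ≤ D i := fun i => (norm_nonneg _).trans (hD i 0)
  have hea : ContDiff ℝ ∞ fun y : Rn n => e (a • y) := he.comp (by fun_prop)
  rcases lt_or_ge (a * ‖x‖) 1 with hx | hx
  · have hev : (fun y => e (a • y) • ψ y) =ᶠ[𝓝 x] fun _ => 0 := by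
      have : ∀ᶠ y in 𝓝 x, a * ‖y‖ < 1 :=
        (continuous_const.mul continuous_norm).continuousAt.eventually_lt continuousAt_const hx
      filter_upwards [this] with y hy
      rw [he0 _ (by rwa [norm_smul, Real.norm_of_nonneg ha.le]), zero_smul]
    rw [(hev.iteratedFDeriv ℝ m).eq_of_nhds, iteratedFDeriv_fun_zero]
    simp only [norm_zero, mul_zero, Pi.zero_apply]
    exact mul_nonneg ha.le (Finset.sum_nonneg fun i _ =>
      mul_nonneg (mul_nonneg (by positivity) (hD0 i)) (apply_nonneg _ _))
  · have key := norm_iteratedFDeriv_smul_le hea (ψ.smooth ⊤) x (n := m) (by exact_mod_cast le_top)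
    -- Where the dilated function does not vanish, `a‖x‖ ≥ 1`; spending one extra power of decay of
    -- `ψ` buys the factor `a`.
    have h1 : ‖x‖ ^ k ≤ a * ‖x‖ ^ (k + 1) := by
      rw [pow_succ]
      nlinarith [pow_nonneg (norm_nonneg x) k]
    calc _ ≤ (a * ‖x‖ ^ (k + 1)) * _ := mul_le_mul h1 key (norm_nonneg _) (by positivity)
      _ = a * ∑ i ∈ Finset.range (m + 1),
          (m.choose i : ℝ) * ‖iteratedFDeriv ℝ i (fun y : Rn n => e (a • y)) x‖ *
            (‖x‖ ^ (k + 1) * ‖iteratedFDeriv ℝ (m - i) ψ x‖) := by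
        rw [mul_assoc, Finset.mul_sum]
        congr 1
        exact Finset.sum_congr rfl fun i _ => by ring
      _ ≤ _ := by
        gcongr with i hi
        · exact mul_nonneg (by positivity) (hD0 i)
        · rw [iteratedFDeriv_comp_const_smul a (he.of_le (by exact_mod_cast le_top)), norm_smul,
            norm_pow, Real.norm_of_nonneg ha.le]
          exact (mul_le_of_le_one_left (norm_nonneg _) (pow_le_one₀ ha.le ha1)).trans (hD _ _)
        · exact SchwartzMap.le_seminorm ℂ _ _ ψ x

/-- Every Schwartz function is a limit, in the Schwartz topology and pointwise, of compactly
supported Schwartz functions that it dominates. -/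
lemma exists_seq_hasCompactSupport_tendsto {n : ℕ} (ψ : 𝓢(Rn n, ℂ)) :
    ∃ Ψ : ℕ → 𝓢(Rn n, ℂ), (∀ j, HasCompactSupport (Ψ j)) ∧ (∀ j x, ‖Ψ j x‖ ≤ ‖ψ x‖) ∧
      (∀ x, Tendsto (fun j => Ψ j x) atTop (𝓝 (ψ x))) ∧ Tendsto Ψ atTop (𝓝 ψ) := by
  let χ : ContDiffBump (0 : Rn n) := ⟨1, 2, one_pos, one_lt_two⟩
  have hχ : ContDiff ℝ ∞ χ := χ.contDiff
  -- The truncation error is `ψ` times a dilate of `1 - χ`, which vanishes on ever larger balls.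
  let e : Rn n → ℝ := fun x => 1 - χ x
  have he : ContDiff ℝ ∞ e := contDiff_const.sub hχ
  have hbound : ∀ i, ∃ D, ∀ x, ‖iteratedFDeriv ℝ i e x‖ ≤ D := by
    intro i
    have hcont : Continuous (iteratedFDeriv ℝ i χ) :=
      hχ.continuous_iteratedFDeriv (by exact_mod_cast le_top)
    obtain ⟨D, hD⟩ := hcont.bounded_above_of_compact_support (χ.hasCompactSupport.iteratedFDeriv i)
    obtain ⟨D', hD'⟩ : ∃ D', ∀ x : Rn n, ‖iteratedFDeriv ℝ i (fun _ : Rn n => (1 : ℝ)) x‖ ≤ D' := by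
      rcases Nat.eq_zero_or_pos i with rfl | hi
      · exact ⟨1, fun x => by simp⟩
      · exact ⟨0, fun x => by rw [iteratedFDeriv_const_of_ne hi.ne']; simp⟩
    refine ⟨D' + D, fun x => ?_⟩
    have : iteratedFDeriv ℝ i e x = iteratedFDeriv ℝ i (fun _ : Rn n => (1 : ℝ)) x -
        iteratedFDeriv ℝ i χ x := by
      have := iteratedFDeriv_sub_apply (𝕜 := ℝ) (i := i) (x := x)
        (f := fun _ : Rn n => (1 : ℝ)) (g := χ) contDiff_const.contDiffAt
        (hχ.of_le (by exact_mod_cast le_top)).contDiffAt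
      exact this
    rw [this]
    exact (norm_sub_le _ _).trans (add_le_add (hD' x) (hD x))
  choose D hD using hbound
  have he0 : ∀ x, ‖x‖ < 1 → e x = 0 := fun x hx => by
    have : χ x = 1 := χ.one_of_mem_closedBall (by simpa using hx.le)
    simp [e, this]
  let a : ℕ → ℝ := fun j => 1 / ((j : ℝ) + 1)
  have ha : ∀ j, 0 < a j := fun j => Nat.one_div_pos_of_nat
  have ha1 : ∀ j, a j ≤ 1 := fun j => by
    simp only [a]
    rw [div_le_one (by positivity)]
    linarith [j.cast_nonneg (α := ℝ)]
  have ha0 : Tendsto a atTop (𝓝 0) := tendsto_one_div_add_atTop_nhds_zero_nat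
  have hcs : ∀ j, HasCompactSupport fun x : Rn n => χ (a j • x) • ψ x := fun j =>
    (χ.hasCompactSupport.comp_smul (ha j).ne').smul_right
  have hsm : ∀ j, ContDiff ℝ ∞ fun x : Rn n => χ (a j • x) • ψ x := fun j =>
    (hχ.comp (contDiff_const_smul (a j))).smul (ψ.smooth ⊤)
  have hval : ∀ j x, ((hcs j).toSchwartzMap (hsm j)) x = χ (a j • x) • ψ x := fun j x => rfl
  refine ⟨fun j => (hcs j).toSchwartzMap (hsm j), hcs, fun j x => ?_, fun x => ?_, ?_⟩
  · rw [hval, norm_smul, Real.norm_of_nonneg χ.nonneg]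
    exact mul_le_of_le_one_left (norm_nonneg _) χ.le_one
  · simp only [hval]
    have h1 : Tendsto (fun j => χ (a j • x)) atTop (𝓝 (χ ((0 : ℝ) • x))) :=
      (hχ.continuous.tendsto _).comp (ha0.smul_const x)
    have h2 : χ ((0 : ℝ) • x) = 1 := by
      rw [zero_smul]; exact χ.one_of_mem_closedBall (by simp [χ])
    rw [h2] at h1
    simpa using h1.smul_const (ψ x)
  · rw [(schwartz_withSeminorms ℂ (Rn n) ℂ).tendsto_nhds]
    rintro ⟨k, m⟩ ε hε
    set S := ∑ i ∈ Finset.range (m + 1),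
      (m.choose i : ℝ) * D i * SchwartzMap.seminorm ℂ (k + 1) (m - i) ψ
    have hle : ∀ j, SchwartzMap.seminorm ℂ k m ((hcs j).toSchwartzMap (hsm j) - ψ) ≤ a j * S := by
      intro j
      have hpt := norm_pow_mul_iteratedFDeriv_smul_le he hD he0 ψ k m (ha j) (ha1 j)
      rw [map_sub_rev]
      refine SchwartzMap.seminorm_le_bound ℂ k m _ ?_ fun x => ?_
      · exact le_trans (by positivity) (hpt 0)
      · have : ⇑(ψ - (hcs j).toSchwartzMap (hsm j)) = fun y => e (a j • y) • ψ y := by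
          ext y
          simp only [sub_apply, hval, e, sub_smul, one_smul]
        rw [this]
        exact hpt x
    have hlim : Tendsto (fun j => a j * S) atTop (𝓝 0) := by simpa using ha0.mul_const S
    filter_upwards [hlim.eventually (gt_mem_nhds hε)] with j hj
    exact (hle j).trans_lt hj

end SchwartzDensity

/-! ### The heat semigroup on the Fourier side -/

/-- On the ball `ψ` is bounded and `G` integrable; off the ball `G` is bounded and `ψ` integrable.
-/
lemma integrable_schwartz_smul {n : ℕ} {F : Type*} [NormedAddCommGroup F] [NormedSpace ℂ F]
    {G : Rn n → F} (hG : LocallyIntegrable G volume) {r K : ℝ}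
    (hK : ∀ᵐ ζ, r ≤ ‖ζ‖ → ‖G ζ‖ ≤ K) (ψ : 𝓢(Rn n, ℂ)) :
    Integrable (fun ζ => ψ ζ • G ζ) volume := by
  have hm : AEStronglyMeasurable (fun ζ => ψ ζ • G ζ) volume :=
    ψ.continuous.aestronglyMeasurable.smul hG.aestronglyMeasurable
  obtain ⟨C, hC⟩ : ∃ C, ∀ x, ‖ψ x‖ ≤ C :=
    ⟨_, fun x => by simpa using SchwartzMap.norm_le_seminorm ℂ ψ x⟩
  have h1 : IntegrableOn (fun ζ => ψ ζ • G ζ) (Metric.closedBall 0 r) volume :=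
    Integrable.bdd_smul (hG.integrableOn_isCompact (isCompact_closedBall 0 r)) C
      ψ.continuous.aestronglyMeasurable (ae_of_all _ hC)
  have h2 : IntegrableOn (fun ζ => ψ ζ • G ζ) (Metric.closedBall 0 r)ᶜ volume := by
    refine Integrable.mono' ((ψ.integrable (μ := volume)).norm.mul_const K).integrableOn
      hm.restrict ?_
    rw [ae_restrict_iff' Metric.isClosed_closedBall.measurableSet.compl]
    filter_upwards [hK] with ζ hζ hr
    have : r ≤ ‖ζ‖ := by simpa using (not_le.mp fun h => hr (by simpa using h)).le
    rw [norm_smul]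
    exact mul_le_mul_of_nonneg_left (hζ this) (norm_nonneg _)
  have := h1.union h2
  rwa [union_compl_self, integrableOn_univ] at this

/-- A tempered distribution that is a function, bounded far away from the origin, is given by
integration against all Schwartz functions. -/
lemma IsFunction.apply_eq_integral {n : ℕ} {F : Type*} [NormedAddCommGroup F] [NormedSpace ℂ F]
    {u : 𝓢'(Rn n, F)} {G : Rn n → F} (hu : IsFunction u G) {r K : ℝ}
    (hK : ∀ᵐ ζ, r ≤ ‖ζ‖ → ‖G ζ‖ ≤ K) (ψ : 𝓢(Rn n, ℂ)) : u ψ = ∫ ζ, ψ ζ • G ζ := by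
  -- `IsFunction` only tests against compact supports. Both sides pass to the limit: the left by
  -- continuity of `u`, the right by domination.
  obtain ⟨Ψ, hcs, hle, hpt, hlim⟩ := exists_seq_hasCompactSupport_tendsto ψ
  have h1 : Tendsto (fun j => u (Ψ j)) atTop (𝓝 (u ψ)) := ((map_continuous u).tendsto ψ).comp hlim
  have h2 : Tendsto (fun j => ∫ ζ, Ψ j ζ • G ζ) atTop (𝓝 (∫ ζ, ψ ζ • G ζ)) := by
    refine tendsto_integral_of_dominated_convergence (fun ζ => ‖ψ ζ • G ζ‖) (fun j => ?_)
      (integrable_schwartz_smul hu.1 hK ψ).norm (fun j => ae_of_all _ fun ζ => ?_)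
      (ae_of_all _ fun ζ => (hpt ζ).smul_const _)
    · exact (Ψ j).continuous.aestronglyMeasurable.smul hu.1.aestronglyMeasurable
    · rw [norm_smul, norm_smul]
      exact mul_le_mul_of_nonneg_right (hle j ζ) (norm_nonneg _)
  simp only [hu.2 _ (hcs _)] at h1
  exact tendsto_nhds_unique h1 h2

/-- The translation becomes a phase after a shift of the variable. In the remaining Gaussian
integral the factor `(4πt)^{n/2}` cancels the normalization of the kernel. -/
lemma fourierInv_heatKernel_translate {n : ℕ} {t : ℝ} (ht : 0 < t) (y ζ : Rn n) :
    𝓕⁻ (SchwartzMap.compSubConstCLM ℂ y (heatKernel n t ht)) ζ =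
      Complex.exp (((2 * Real.pi * inner ℝ ζ y : ℝ) : ℂ) * Complex.I) *
        ((Real.exp (-(4 * Real.pi ^ 2 * t) * ‖ζ‖ ^ 2) : ℝ) : ℂ) := by
  have hb : 0 < ((1 / (4 * t) : ℝ) : ℂ).re := by rw [Complex.ofReal_re]; positivity
  have hpi : (0 : ℝ) < 4 * Real.pi * t := by positivity
  rw [SchwartzMap.fourierInv_coe, Real.fourierInv_eq']
  rw [← integral_add_right_eq_self _ y]
  have h1 : ∀ v : Rn n,
      Complex.exp (((2 * Real.pi * inner ℝ (v + y) ζ : ℝ) : ℂ) * Complex.I) •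
        (SchwartzMap.compSubConstCLM ℂ y (heatKernel n t ht)) (v + y) =
      (Complex.exp (((2 * Real.pi * inner ℝ ζ y : ℝ) : ℂ) * Complex.I) *
        (((4 * Real.pi * t) ^ (-(n : ℝ) / 2) : ℝ) : ℂ)) *
        Complex.exp (-((1 / (4 * t) : ℝ) : ℂ) * (‖v‖ : ℂ) ^ 2 +
          (2 * Real.pi * Complex.I) * ((inner ℝ ζ v : ℝ) : ℂ)) := by
    intro v
    rw [SchwartzMap.compSubConstCLM_apply, add_sub_cancel_right, heatKernel_apply, smul_eq_mul,
      inner_add_left, real_inner_comm ζ v, real_inner_comm ζ y, Complex.exp_add]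
    rw [mul_add, Complex.ofReal_add, add_mul, Complex.exp_add]
    push_cast
    rw [show -((1 : ℂ) / (4 * t)) * (‖v‖ : ℂ) ^ 2 = -(‖v‖ : ℂ) ^ 2 / (4 * t) by ring,
      show 2 * (Real.pi : ℂ) * Complex.I * ((inner ℝ ζ v : ℝ) : ℂ) =
        2 * (Real.pi : ℂ) * ((inner ℝ ζ v : ℝ) : ℂ) * Complex.I by ring]
    ring
  simp_rw [h1]
  rw [integral_const_mul, GaussianFourier.integral_cexp_neg_mul_sq_norm_add hb, finrank_euclideanSpace,
    Fintype.card_fin, mul_assoc]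
  congr 1
  have h2 : ((Real.pi : ℂ) / ((1 / (4 * t) : ℝ) : ℂ)) ^ ((n : ℂ) / 2) =
      (((4 * Real.pi * t) ^ ((n : ℝ) / 2) : ℝ) : ℂ) := by
    rw [Complex.ofReal_cpow hpi.le]
    congr 1
    · push_cast; field_simp
    · push_cast; rfl
  rw [h2, ← mul_assoc, ← Complex.ofReal_mul, ← Real.rpow_add hpi, neg_div, neg_add_cancel,
    Real.rpow_zero, Complex.ofReal_one, one_mul, Complex.ofReal_exp]
  congr 1
  push_cast
  rw [mul_pow, Complex.I_sq]
  field_simp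
  ring

/-- `e^{tΔ} f` is the inverse Fourier transform of `exp(-4π²t|ζ|²) 𝓕f(ζ)`. -/
lemma heat_eq_fourierInv {n : ℕ} {F : Type*} [NormedAddCommGroup F] [NormedSpace ℂ F]
    {f : 𝓢'(Rn n, F)} {G : Rn n → F} (hf : IsFunction (𝓕 f) G) {r K : ℝ}
    (hK : ∀ᵐ ζ, r ≤ ‖ζ‖ → ‖G ζ‖ ≤ K) {t : ℝ} (ht : 0 < t) (y : Rn n) :
    heat t f y =
      𝓕⁻ (fun ζ => ((Real.exp (-(4 * Real.pi ^ 2 * t) * ‖ζ‖ ^ 2) : ℝ) : ℂ) • G ζ) y := by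
  rw [heat, dif_pos ht]
  -- Writing the translated heat kernel as a Fourier transform moves the transform onto `f`, so that
  -- `𝓕 f` can be evaluated as a function.
  have hinv : 𝓕 (𝓕⁻ (SchwartzMap.compSubConstCLM ℂ y (heatKernel n t ht)) : 𝓢(Rn n, ℂ)) =
      SchwartzMap.compSubConstCLM ℂ y (heatKernel n t ht) :=
    FourierTransform.fourier_fourierInv_eq _
  rw [← hinv, ← TemperedDistribution.fourier_apply, hf.apply_eq_integral hK, Real.fourierInv_eq']
  refine integral_congr_ae (ae_of_all _ fun ζ => ?_)
  simp only
  rw [fourierInv_heatKernel_translate, mul_smul]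

/-! ### A Gaussian-weighted `L²` bound for inverse Fourier transforms -/

section Weighted

variable {n : ℕ} {F : Type*} [NormedAddCommGroup F] [InnerProductSpace ℂ F] [CompleteSpace F]

/-- The square is a double integral with phase `e^{2πi⟨ζ-η,y⟩}`; integrating in `y` first turns the
phase into the transform of the weight at `ζ - η`. Fubini applies because `v` is integrable and the
weight is Gaussian. -/
lemma integral_gaussian_mul_norm_sq_fourierInv {b : ℝ} (hb : 0 < b) {v : Rn n → F}
    (hv : Integrable v volume) :
    ((∫ y : Rn n, Real.exp (-b * ‖y‖ ^ 2) * ‖𝓕⁻ v y‖ ^ 2 : ℝ) : ℂ) =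
      ∫ p : Rn n × Rn n, ((((Real.pi / b) ^ ((n : ℝ) / 2) *
        Real.exp (-Real.pi ^ 2 * ‖p.1 - p.2‖ ^ 2 / b) : ℝ)) : ℂ) * inner ℂ (v p.2) (v p.1) := by
  set E : Rn n → Rn n → ℂ := fun ζ y => Complex.exp (((2 * Real.pi * inner ℝ ζ y : ℝ) : ℂ) * Complex.I)
    with hE
  have hEn : ∀ ζ y, ‖E ζ y‖ = 1 := fun ζ y => Complex.norm_exp_ofReal_mul_I _
  have hEc : Continuous fun p : Rn n × Rn n => E p.1 p.2 := by
    simp only [hE]; fun_prop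
  have hbre : 0 < (b : ℂ).re := hb
  have hEv : ∀ y, Integrable (fun ζ => E ζ y • v ζ) volume := fun y =>
    Integrable.bdd_smul hv 1 (hEc.comp (by fun_prop : Continuous fun ζ => (ζ, y))).aestronglyMeasurable
      (ae_of_all _ fun ζ => (hEn ζ y).le)
  have hvv : Integrable (fun p : Rn n × Rn n => (inner ℂ (v p.2) (v p.1) : ℂ)) (volume.prod volume) := by
    refine Integrable.mono' (hv.norm.mul_prod hv.norm) ?_ (ae_of_all _ fun p => ?_)
    · exact (hv.1.comp_snd).inner (hv.1.comp_fst)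
    · rw [mul_comm]; exact norm_inner_le_norm _ _
  have hsq : ∀ y, (((‖𝓕⁻ v y‖ ^ 2 : ℝ)) : ℂ) =
      ∫ p : Rn n × Rn n, E (p.1 - p.2) y * inner ℂ (v p.2) (v p.1) := by
    intro y
    have hprod : Integrable (fun p : Rn n × Rn n => E (p.1 - p.2) y * inner ℂ (v p.2) (v p.1))
        (volume.prod volume) :=
      hvv.bdd_mul (hEc.comp (by fun_prop :
        Continuous fun p : Rn n × Rn n => (p.1 - p.2, y))).aestronglyMeasurable
        (ae_of_all _ fun p => (hEn _ y).le)
    have h1 : (((‖𝓕⁻ v y‖ ^ 2 : ℝ)) : ℂ) = inner ℂ (𝓕⁻ v y) (𝓕⁻ v y) := by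
      rw [inner_self_eq_norm_sq_to_K]; push_cast; rfl
    rw [h1, Real.fourierInv_eq', ← integral_inner (hEv y), Measure.volume_eq_prod,
      integral_prod _ hprod]
    refine integral_congr_ae (ae_of_all _ fun ζ => ?_)
    simp only
    -- `integral_inner` acts on the second slot; conjugation swaps the slots so that it also serves
    -- for the first.
    rw [← inner_conj_symm, ← integral_inner (hEv y), ← integral_conj]
    refine integral_congr_ae (ae_of_all _ fun η => ?_)
    simp only [inner_conj_symm]
    rw [inner_smul_left, inner_smul_right, ← mul_assoc]
    congr 1
    simp only [hE]
    rw [← Complex.exp_conj, ← Complex.exp_add, inner_sub_left]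
    congr 1
    simp only [map_mul, Complex.conj_ofReal, Complex.conj_I]
    push_cast
    ring
  have hgauss : Integrable (fun y : Rn n => Complex.exp (-(b : ℂ) * (‖y‖ : ℂ) ^ 2)) volume := by
    simpa using GaussianFourier.integrable_cexp_neg_mul_sq_norm_add hbre 0 (0 : Rn n)
  have htriple : Integrable (Function.uncurry fun (y : Rn n) (p : Rn n × Rn n) =>
      Complex.exp (-(b : ℂ) * (‖y‖ : ℂ) ^ 2) * (E (p.1 - p.2) y * inner ℂ (v p.2) (v p.1)))
      (volume.prod volume) := by
    have h1 : Integrable (fun q : Rn n × Rn n × Rn n => E (q.2.1 - q.2.2) q.1 *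
        (Complex.exp (-(b : ℂ) * (‖q.1‖ : ℂ) ^ 2) * inner ℂ (v q.2.2) (v q.2.1)))
        (volume.prod (volume.prod volume)) :=
      (hgauss.mul_prod hvv).bdd_mul (hEc.comp (by fun_prop :
        Continuous fun q : Rn n × Rn n × Rn n => (q.2.1 - q.2.2, q.1))).aestronglyMeasurable
        (ae_of_all _ fun q => (hEn _ _).le)
    refine h1.congr (ae_of_all _ fun q => ?_)
    simp only [Function.uncurry]
    ring
  rw [← integral_complex_ofReal]
  have h2 : ∀ y : Rn n, ((Real.exp (-b * ‖y‖ ^ 2) * ‖𝓕⁻ v y‖ ^ 2 : ℝ) : ℂ) =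
      ∫ p : Rn n × Rn n, Complex.exp (-(b : ℂ) * (‖y‖ : ℂ) ^ 2) *
        (E (p.1 - p.2) y * inner ℂ (v p.2) (v p.1)) := by
    intro y
    rw [integral_const_mul, ← hsq]
    push_cast
    rfl
  simp_rw [h2]
  rw [integral_integral_swap htriple]
  refine integral_congr_ae (ae_of_all _ fun p => ?_)
  have h3 : ∀ y : Rn n, Complex.exp (-(b : ℂ) * (‖y‖ : ℂ) ^ 2) *
        (E (p.1 - p.2) y * inner ℂ (v p.2) (v p.1)) =
      inner ℂ (v p.2) (v p.1) * Complex.exp (-(b : ℂ) * (‖y‖ : ℂ) ^ 2 +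
        (2 * Real.pi * Complex.I) * ((inner ℝ (p.1 - p.2) y : ℝ) : ℂ)) := by
    intro y
    rw [Complex.exp_add]
    simp only [hE]
    push_cast
    ring_nf
  simp only [h3]
  rw [integral_const_mul, GaussianFourier.integral_cexp_neg_mul_sq_norm_add hbre,
    finrank_euclideanSpace, Fintype.card_fin, mul_comm]
  congr 1
  rw [Complex.ofReal_mul, Complex.ofReal_cpow (by positivity), Complex.ofReal_exp]
  push_cast
  congr 2
  rw [mul_pow, Complex.I_sq]
  field_simp
  ring

/-- Absolute values are taken only after the `y`-integration, when the oscillation has already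
become decay in `ζ - η`. -/
lemma lintegral_gaussian_mul_enorm_sq_fourierInv_le {b : ℝ} (hb : 0 < b) {v : Rn n → F}
    (hv : Integrable v volume) :
    ∫⁻ y : Rn n, ENNReal.ofReal (Real.exp (-b * ‖y‖ ^ 2)) * ‖𝓕⁻ v y‖ₑ ^ 2 ≤
      ENNReal.ofReal ((Real.pi / b) ^ ((n : ℝ) / 2)) *
        ∫⁻ ζ : Rn n, ∫⁻ η : Rn n, ‖v ζ‖ₑ * ‖v η‖ₑ *
          ENNReal.ofReal (Real.exp (-Real.pi ^ 2 * ‖ζ - η‖ ^ 2 / b)) := by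
  have hcont : Continuous (𝓕⁻ v) := by
    have := VectorFourier.fourierIntegral_continuous (L := -innerₗ (Rn n)) (e := Real.fourierChar)
      Real.continuous_fourierChar
      (continuous_neg.comp (continuous_inner (𝕜 := ℝ) (E := Rn n))) hv
    exact this
  have hbd : ∀ y, ‖𝓕⁻ v y‖ ≤ ∫ ζ, ‖v ζ‖ := fun y => by
    rw [Real.fourierInv_eq']
    refine (norm_integral_le_integral_norm _).trans_eq (integral_congr_ae (ae_of_all _ fun ζ => ?_))
    simp only [norm_smul, Complex.norm_exp_ofReal_mul_I, one_mul]
  have hint : Integrable (fun y : Rn n => Real.exp (-b * ‖y‖ ^ 2) * ‖𝓕⁻ v y‖ ^ 2) volume := by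
    have hg : Integrable (fun y : Rn n => Real.exp (-b * ‖y‖ ^ 2)) volume := (gaussian n b hb).integrable
    refine hg.mul_bdd (c := (∫ ζ, ‖v ζ‖) ^ 2) (hcont.norm.pow 2).aestronglyMeasurable
      (ae_of_all _ fun y => ?_)
    rw [norm_pow, norm_norm]
    exact pow_le_pow_left₀ (norm_nonneg _) (hbd y) 2
  have hL : ∫⁻ y : Rn n, ENNReal.ofReal (Real.exp (-b * ‖y‖ ^ 2)) * ‖𝓕⁻ v y‖ₑ ^ 2 =
      ENNReal.ofReal (∫ y : Rn n, Real.exp (-b * ‖y‖ ^ 2) * ‖𝓕⁻ v y‖ ^ 2) := by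
    rw [ofReal_integral_eq_lintegral_ofReal hint (ae_of_all _ fun y => by positivity)]
    refine lintegral_congr fun y => ?_
    rw [ENNReal.ofReal_mul (by positivity), ENNReal.ofReal_pow (norm_nonneg _), ofReal_norm]
  have hpos : 0 ≤ ∫ y : Rn n, Real.exp (-b * ‖y‖ ^ 2) * ‖𝓕⁻ v y‖ ^ 2 :=
    integral_nonneg fun y => by positivity
  have hnorm : ENNReal.ofReal (∫ y : Rn n, Real.exp (-b * ‖y‖ ^ 2) * ‖𝓕⁻ v y‖ ^ 2) =
      ‖((∫ y : Rn n, Real.exp (-b * ‖y‖ ^ 2) * ‖𝓕⁻ v y‖ ^ 2 : ℝ) : ℂ)‖ₑ := by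
    rw [← ofReal_norm, Complex.norm_real, Real.norm_of_nonneg hpos]
  rw [hL, hnorm, integral_gaussian_mul_norm_sq_fourierInv hb hv]
  refine (enorm_integral_le_lintegral_enorm _).trans ?_
  have hmeas : AEMeasurable (fun p : Rn n × Rn n => ‖v p.1‖ₑ * ‖v p.2‖ₑ *
      ENNReal.ofReal (Real.exp (-Real.pi ^ 2 * ‖p.1 - p.2‖ ^ 2 / b))) (volume.prod volume) := by
    refine ((hv.1.comp_fst).enorm.mul (hv.1.comp_snd).enorm).mul ?_
    exact (ENNReal.continuous_ofReal.comp (by fun_prop)).aemeasurable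
  rw [← lintegral_prod (fun p : Rn n × Rn n => ‖v p.1‖ₑ * ‖v p.2‖ₑ *
      ENNReal.ofReal (Real.exp (-Real.pi ^ 2 * ‖p.1 - p.2‖ ^ 2 / b))) hmeas,
    ← lintegral_const_mul'' _ hmeas, Measure.volume_eq_prod]
  refine lintegral_mono fun p => ?_
  rw [← ofReal_norm, norm_mul, Complex.norm_real, Real.norm_of_nonneg (by positivity),
    ← ofReal_norm (v p.1), ← ofReal_norm (v p.2), ← ENNReal.ofReal_mul (norm_nonneg _),
    ← ENNReal.ofReal_mul (by positivity), ← ENNReal.ofReal_mul (by positivity)]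
  refine ENNReal.ofReal_le_ofReal ?_
  have := norm_inner_le_norm (𝕜 := ℂ) (v p.2) (v p.1)
  calc _ ≤ (Real.pi / b) ^ ((n : ℝ) / 2) * Real.exp (-Real.pi ^ 2 * ‖p.1 - p.2‖ ^ 2 / b) *
        (‖v p.2‖ * ‖v p.1‖) := by gcongr
    _ = _ := by ring

/-- Mean squares of an inverse Fourier transform over balls of radius `R`. -/
lemma lintegral_ball_enorm_sq_fourierInv_le {v : Rn n → F} (hv : Integrable v volume)
    (x : Rn n) {R : ℝ} (hR : 0 < R) :
    ∫⁻ y in Metric.ball x R, ‖𝓕⁻ v y‖ₑ ^ 2 ≤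
      ENNReal.ofReal (Real.exp Real.pi * R ^ n) *
        ∫⁻ ζ : Rn n, ∫⁻ η : Rn n, ‖v ζ‖ₑ * ‖v η‖ₑ *
          ENNReal.ofReal (Real.exp (-Real.pi * R ^ 2 * ‖ζ - η‖ ^ 2)) := by
  -- Modulating `v` moves the centre of the ball to the origin without changing `‖v‖`.
  set w : Rn n → F := fun ζ =>
    Complex.exp (((2 * Real.pi * inner ℝ ζ x : ℝ) : ℂ) * Complex.I) • v ζ with hw
  have hwn : ∀ ζ, ‖w ζ‖ₑ = ‖v ζ‖ₑ := fun ζ => by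
    rw [← ofReal_norm, ← ofReal_norm]
    simp only [hw, norm_smul, Complex.norm_exp_ofReal_mul_I, one_mul]
  have hwi : Integrable w volume := by
    refine Integrable.bdd_smul hv 1 (Continuous.aestronglyMeasurable (by fun_prop))
      (ae_of_all _ fun ζ => (Complex.norm_exp_ofReal_mul_I _).le)
  have hshift : ∀ y, 𝓕⁻ v (y + x) = 𝓕⁻ w y := fun y => by
    rw [Real.fourierInv_eq', Real.fourierInv_eq']
    refine integral_congr_ae (ae_of_all _ fun ζ => ?_)
    simp only [hw]
    rw [smul_smul, ← Complex.exp_add, inner_add_right]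
    congr 2
    push_cast
    ring
  -- With `b = π/R²` the weight is at least `e^{-π}` on the ball, and `(π/b)^{n/2} = R^n` is the
  -- scale of its volume.
  have hb : 0 < Real.pi / R ^ 2 := by positivity
  calc ∫⁻ y in Metric.ball x R, ‖𝓕⁻ v y‖ₑ ^ 2
      ≤ ∫⁻ y in Metric.ball x R, ENNReal.ofReal (Real.exp Real.pi) *
          (ENNReal.ofReal (Real.exp (-(Real.pi / R ^ 2) * ‖y - x‖ ^ 2)) * ‖𝓕⁻ v y‖ₑ ^ 2) := by
        refine setLIntegral_mono' measurableSet_ball fun y hy => ?_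
        rw [← mul_assoc, ← ENNReal.ofReal_mul (by positivity), ← Real.exp_add]
        refine le_mul_of_one_le_left zero_le ?_
        rw [ENNReal.one_le_ofReal, Real.one_le_exp_iff]
        have hy' : ‖y - x‖ ≤ R := by simpa [dist_eq_norm] using (Metric.mem_ball.mp hy).le
        have : Real.pi / R ^ 2 * ‖y - x‖ ^ 2 ≤ Real.pi / R ^ 2 * R ^ 2 := by gcongr
        rw [div_mul_cancel₀ _ (by positivity)] at this
        linarith
    _ ≤ ∫⁻ y, ENNReal.ofReal (Real.exp Real.pi) *
          (ENNReal.ofReal (Real.exp (-(Real.pi / R ^ 2) * ‖y - x‖ ^ 2)) * ‖𝓕⁻ v y‖ₑ ^ 2) :=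
        setLIntegral_le_lintegral _ _
    _ = ENNReal.ofReal (Real.exp Real.pi) * ∫⁻ y : Rn n,
          ENNReal.ofReal (Real.exp (-(Real.pi / R ^ 2) * ‖y‖ ^ 2)) * ‖𝓕⁻ w y‖ₑ ^ 2 := by
        rw [lintegral_const_mul' _ _ ENNReal.ofReal_ne_top, ← lintegral_add_right_eq_self _ x]
        simp only [add_sub_cancel_right, hshift]
    _ ≤ _ := mul_le_mul_right (lintegral_gaussian_mul_enorm_sq_fourierInv_le hb hwi) _
    _ = _ := by
        have h1 : (Real.pi / (Real.pi / R ^ 2)) ^ ((n : ℝ) / 2) = R ^ n := by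
          rw [div_div_cancel₀ Real.pi_ne_zero, ← Real.rpow_natCast R 2, ← Real.rpow_mul hR.le]
          rw [← Real.rpow_natCast R n]
          congr 1
          push_cast
          ring
        rw [h1, ← mul_assoc, ← ENNReal.ofReal_mul (by positivity)]
        congr 1
        simp only [hwn]
        have h2 : ∀ s : ℝ, -Real.pi ^ 2 * s / (Real.pi / R ^ 2) = -Real.pi * R ^ 2 * s := by
          intro s
          field_simp
        simp only [h2]

end Weighted

/-! ### Dilations -/

lemma quasiMeasurePreserving_const_smul {n : ℕ} {c : ℝ} (hc : c ≠ 0) :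
    Measure.QuasiMeasurePreserving (fun x : Rn n => c • x) volume volume := by
  refine ⟨measurable_const_smul c, ?_⟩
  rw [Measure.map_addHaar_smul volume hc]
  exact Measure.smul_absolutelyContinuous

lemma lintegral_comp_const_smul {n : ℕ} {c : ℝ} (hc : 0 < c) (f : Rn n → ℝ≥0∞) :
    ∫⁻ x, f (c • x) = ENNReal.ofReal ((c ^ n)⁻¹) * ∫⁻ x, f x := by
  have h1 := (Homeomorph.smulOfNeZero c hc.ne' (α := Rn n)).measurableEmbedding.lintegral_map f
    (μ := volume)
  have h2 : Measure.map (Homeomorph.smulOfNeZero c hc.ne' (α := Rn n)) volume =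
      ENNReal.ofReal ((c ^ n)⁻¹) • volume := by
    have := Measure.map_addHaar_smul (volume : Measure (Rn n)) hc.ne'
    rw [finrank_euclideanSpace, Fintype.card_fin, abs_of_pos (by positivity)] at this
    exact this
  rw [h2, lintegral_smul_measure] at h1
  exact h1.symm

/-! ### Reduction of the `BMO⁻¹` bound to a quadratic form -/

/-- `∬ h(ξ) h(η) exp(-R²|ξ-η|²/(4π)) dξ dη`. -/
def gaussForm {n : ℕ} (h : Rn n → ℝ≥0∞) (R : ℝ) : ℝ≥0∞ :=
  ∫⁻ ξ : Rn n, ∫⁻ η : Rn n, h ξ * h η *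
    ENNReal.ofReal (Real.exp (-(R ^ 2 * ‖ξ - η‖ ^ 2 / (4 * Real.pi))))

/-- The Gaussian depends only on `R|ξ-η|`, so dilating `h` is matched by dilating `R`, with one
Jacobian `c^{-n}` per variable. This serves both the `2π` normalization and the homogeneous
majorant. -/
lemma gaussForm_comp_const_smul {n : ℕ} (h : Rn n → ℝ≥0∞) {c : ℝ} (hc : 0 < c) (R : ℝ) :
    gaussForm (fun ξ => h (c • ξ)) (c * R) = ENNReal.ofReal ((c ^ n)⁻¹) ^ 2 * gaussForm h R := by
  have h1 : ∀ ζ η : Rn n, (c * R) ^ 2 * ‖ζ - η‖ ^ 2 = R ^ 2 * ‖c • ζ - c • η‖ ^ 2 := by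
    intro ζ η
    rw [← smul_sub, norm_smul, Real.norm_of_nonneg hc.le]
    ring
  have h2 : ∀ ξ : Rn n, ∫⁻ η : Rn n, h ξ * h (c • η) *
      ENNReal.ofReal (Real.exp (-(R ^ 2 * ‖ξ - c • η‖ ^ 2 / (4 * Real.pi)))) =
      ENNReal.ofReal ((c ^ n)⁻¹) * ∫⁻ η : Rn n, h ξ * h η *
      ENNReal.ofReal (Real.exp (-(R ^ 2 * ‖ξ - η‖ ^ 2 / (4 * Real.pi)))) := fun ξ =>
    lintegral_comp_const_smul hc fun η : Rn n => h ξ * h η *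
      ENNReal.ofReal (Real.exp (-(R ^ 2 * ‖ξ - η‖ ^ 2 / (4 * Real.pi))))
  simp only [gaussForm, h1]
  rw [lintegral_comp_const_smul hc fun ξ : Rn n => ∫⁻ η : Rn n, h ξ * h (c • η) *
    ENNReal.ofReal (Real.exp (-(R ^ 2 * ‖ξ - c • η‖ ^ 2 / (4 * Real.pi))))]
  simp only [h2]
  rw [lintegral_const_mul' _ _ ENNReal.ofReal_ne_top, ← mul_assoc, ← sq (ENNReal.ofReal _)]

/-- The constant `4π` in `gaussForm` comes from here: `(2πR)²/(4π) = πR²`. -/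
lemma lintegral_gaussian_form_dilate {n : ℕ} (h : Rn n → ℝ≥0∞) (R : ℝ) :
    ∫⁻ ζ : Rn n, ∫⁻ η : Rn n, h ((2 * Real.pi) • ζ) * h ((2 * Real.pi) • η) *
        ENNReal.ofReal (Real.exp (-Real.pi * R ^ 2 * ‖ζ - η‖ ^ 2)) =
      ENNReal.ofReal (((2 * Real.pi) ^ n)⁻¹) ^ 2 * gaussForm h R := by
  rw [← gaussForm_comp_const_smul h (by positivity), gaussForm]
  have h1 : ∀ s : ℝ, -((2 * Real.pi * R) ^ 2 * s / (4 * Real.pi)) = -Real.pi * R ^ 2 * s := by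
    intro s
    field_simp
    ring
  simp only [h1]

lemma ae_enorm_le_essSup_mul {n : ℕ} {F : Type*} [NormedAddCommGroup F] {h : Rn n → ℝ≥0∞} (hpos : ∀ ξ, 0 < h ξ)
    (hfin : volume {ξ | h ξ = ∞} = 0) (g : Rn n → F) :
    ∀ᵐ ξ, ‖g ξ‖ₑ ≤ essSup (fun ξ => (h ξ)⁻¹ * ‖g ξ‖ₑ) volume * h ξ := by
  have hfin' : ∀ᵐ ξ, h ξ ≠ ∞ := by
    rw [ae_iff]; simpa using hfin
  filter_upwards [hfin', ENNReal.ae_le_essSup fun ξ => (h ξ)⁻¹ * ‖g ξ‖ₑ] with ξ h1 h2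
  rw [← ENNReal.div_eq_inv_mul] at h2
  exact (ENNReal.div_le_iff (hpos ξ).ne' h1).mp h2

section Reduction

variable {n : ℕ} {F : Type*} [NormedAddCommGroup F] [InnerProductSpace ℂ F] [CompleteSpace F]

/-- The heat multiplier makes the transform integrable for each `t > 0` and is then bounded by 1, so
the estimate does not depend on `t`. -/
lemma lintegral_ball_enorm_sq_heat_le {h : Rn n → ℝ≥0∞} {f : 𝓢'(Rn n, F)} {G : Rn n → F}
    (hf : IsFunction (𝓕 f) G) {A : ℝ≥0∞} (hA : A ≠ ∞)
    (hG : ∀ᵐ ζ, ‖G ζ‖ₑ ≤ A * h ((2 * Real.pi) • ζ)) {K : ℝ≥0} (hK : ∀ ξ, 1 ≤ ‖ξ‖ → h ξ ≤ K)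
    {t : ℝ} (ht : 0 < t) (x : Rn n) {R : ℝ} (hR : 0 < R) :
    ∫⁻ y in Metric.ball x R, ‖heat t f y‖ₑ ^ 2 ≤
      ENNReal.ofReal (Real.exp Real.pi * R ^ n) *
        (A ^ 2 * (ENNReal.ofReal (((2 * Real.pi) ^ n)⁻¹) ^ 2 * gaussForm h R)) := by
  have hpi : 1 ≤ 2 * Real.pi := by linarith [Real.pi_gt_three]
  have hbd : ∀ᵐ ζ, 1 ≤ ‖ζ‖ → ‖G ζ‖ ≤ (A * K).toReal := by
    filter_upwards [hG] with ζ hζ hr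
    have h1 : 1 ≤ ‖(2 * Real.pi) • ζ‖ := by
      rw [norm_smul, Real.norm_of_nonneg (by positivity)]
      exact one_le_mul_of_one_le_of_one_le hpi hr
    have h2 : ‖G ζ‖ₑ ≤ A * K := hζ.trans (mul_le_mul_right (hK _ h1) A)
    have h3 := ENNReal.toReal_mono (ENNReal.mul_ne_top hA ENNReal.coe_ne_top) h2
    simpa using h3
  have ha : 0 < 4 * Real.pi ^ 2 * t := by positivity
  set v : Rn n → F := fun ζ => ((Real.exp (-(4 * Real.pi ^ 2 * t) * ‖ζ‖ ^ 2) : ℝ) : ℂ) • G ζ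
  have hv : Integrable v volume := integrable_schwartz_smul hf.1 hbd
    ((gaussian n (4 * Real.pi ^ 2 * t) ha).postcompCLM Complex.ofRealCLM)
  have hvle : ∀ᵐ ζ, ‖v ζ‖ₑ ≤ A * h ((2 * Real.pi) • ζ) := by
    filter_upwards [hG] with ζ hζ
    refine le_trans ?_ hζ
    rw [← ofReal_norm, ← ofReal_norm]
    refine ENNReal.ofReal_le_ofReal ?_
    rw [norm_smul, Complex.norm_real, Real.norm_of_nonneg (Real.exp_nonneg _)]
    refine mul_le_of_le_one_left (norm_nonneg _) (Real.exp_le_one_iff.mpr ?_)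
    nlinarith [sq_nonneg ‖ζ‖]
  simp only [heat_eq_fourierInv hf hbd ht]
  refine (lintegral_ball_enorm_sq_fourierInv_le hv x hR).trans (mul_le_mul_right ?_ _)
  rw [← lintegral_gaussian_form_dilate, ← lintegral_const_mul' _ _ (ENNReal.pow_ne_top hA)]
  refine lintegral_mono_ae ?_
  filter_upwards [hvle] with ζ hζ
  rw [← lintegral_const_mul' _ _ (ENNReal.pow_ne_top hA)]
  refine lintegral_mono_ae ?_
  filter_upwards [hvle] with η hη
  calc _ ≤ (A * h ((2 * Real.pi) • ζ)) * (A * h ((2 * Real.pi) • η)) *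
        ENNReal.ofReal (Real.exp (-Real.pi * R ^ 2 * ‖ζ - η‖ ^ 2)) := by gcongr
    _ = _ := by ring

/-- A bound for the quadratic form `gaussForm` gives a bound for the `BMO_T⁻¹` norm in terms of the
majorization norm. -/
theorem exists_bmoNorm_le_of_gaussForm_le {h : Rn n → ℝ≥0∞} (hpos : ∀ ξ, 0 < h ξ)
    (hfin : volume {ξ | h ξ = ∞} = 0) {K : ℝ≥0} (hK : ∀ ξ, 1 ≤ ‖ξ‖ → h ξ ≤ K)
    {φ : ℝ → ℝ} (hφ : ∀ T, 0 < T → 0 < φ T) {D : ℝ≥0}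
    (hD : ∀ T R, 0 < R → R ^ 2 < T →
      ENNReal.ofReal (R ^ 2) * gaussForm h R ≤ D * ENNReal.ofReal (φ T) ^ 2) :
    ∃ C : ℝ≥0, ∀ (f : 𝓢'(Rn n, F)) (T : ℝ), 0 < T →
      bmoNorm T f ≤ C * ENNReal.ofReal (φ T) * majNorm h f := by
  have hpi : 0 < 2 * Real.pi := by positivity
  set V := volume (Metric.ball (0 : Rn n) 1) with hV
  have hV0 : V ≠ 0 := (Metric.measure_ball_pos volume _ one_pos).ne'
  have hVt : V ≠ ∞ := measure_ball_lt_top.ne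
  set c : ℝ≥0∞ := ENNReal.ofReal ((2 * Real.pi) ^ ((n : ℝ) / 2)) with hc
  -- The summand 1 keeps `Q` nonzero even if `D = 0`, so that the constant can be moved through the
  -- infimum in `majNorm`.
  set Q : ℝ≥0∞ := V⁻¹ * ENNReal.ofReal (Real.exp Real.pi) *
    (c ^ 2 * ENNReal.ofReal (((2 * Real.pi) ^ n)⁻¹) ^ 2) * D + 1 with hQ
  have hQt : Q ≠ ∞ := by
    have : V⁻¹ ≠ ∞ := ENNReal.inv_ne_top.mpr hV0
    finiteness
  have hQ0 : Q ≠ 0 := by simp [hQ]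
  have hQs : Q ^ (1 / 2 : ℝ) ≠ ∞ := ENNReal.rpow_ne_top_of_nonneg (by norm_num) hQt
  have hQs0 : Q ^ (1 / 2 : ℝ) ≠ 0 := by simp [hQ0]
  refine ⟨(Q ^ (1 / 2 : ℝ)).toNNReal, fun f T hT => ?_⟩
  rw [ENNReal.coe_toNNReal hQs]
  have hφT : ENNReal.ofReal (φ T) ≠ 0 := by simpa using hφ T hT
  have hne : Q ^ (1 / 2 : ℝ) * ENNReal.ofReal (φ T) ≠ 0 := mul_ne_zero hQs0 hφT
  have hnt : Q ^ (1 / 2 : ℝ) * ENNReal.ofReal (φ T) ≠ ∞ := by finiteness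
  rw [majNorm, ENNReal.mul_iInf_of_ne hne hnt]
  refine le_iInf fun g => ?_
  rw [ENNReal.mul_iInf_of_ne hne hnt]
  refine le_iInf fun hg => ?_
  set M := essSup (fun ξ => (h ξ)⁻¹ * ‖g ξ‖ₑ) volume with hM
  rcases eq_or_ne M ∞ with hMt | hMt
  · rw [hMt, ENNReal.mul_top hne]; exact le_top
  set G : Rn n → F :=
    fun ζ => (((2 * Real.pi) ^ ((n : ℝ) / 2) : ℝ) : ℂ) • g ((2 * Real.pi) • ζ)
  have hG : ∀ᵐ ζ, ‖G ζ‖ₑ ≤ (c * M) * h ((2 * Real.pi) • ζ) := by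
    filter_upwards [(quasiMeasurePreserving_const_smul hpi.ne').ae
      (ae_enorm_le_essSup_mul hpos hfin g)] with ζ hζ
    rw [mul_assoc]
    refine le_trans (le_of_eq ?_) (mul_le_mul_right hζ c)
    rw [enorm_smul, ← ofReal_norm, Complex.norm_real, Real.norm_of_nonneg (by positivity)]
  have hcM : c * M ≠ ∞ := by finiteness
  refine iSup_le fun x => iSup_le fun R => iSup_le fun hR => iSup_le fun hRT => ?_
  have hheat : ∫⁻ t in Ioo 0 (R ^ 2), ∫⁻ y in Metric.ball x R, ‖heat t f y‖ₑ ^ 2 ≤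
      ENNReal.ofReal (Real.exp Real.pi * R ^ n) * ((c * M) ^ 2 *
        (ENNReal.ofReal (((2 * Real.pi) ^ n)⁻¹) ^ 2 * gaussForm h R)) * ENNReal.ofReal (R ^ 2) := by
    calc _ ≤ ∫⁻ _ in Ioo 0 (R ^ 2), ENNReal.ofReal (Real.exp Real.pi * R ^ n) * ((c * M) ^ 2 *
        (ENNReal.ofReal (((2 * Real.pi) ^ n)⁻¹) ^ 2 * gaussForm h R)) :=
          setLIntegral_mono' measurableSet_Ioo fun t ht =>
            lintegral_ball_enorm_sq_heat_le hg hcM hG hK ht.1 x hR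
      _ = _ := by rw [setLIntegral_const, Real.volume_Ioo, sub_zero]
  have hvol : volume (Metric.ball x R) = ENNReal.ofReal (R ^ n) * V := by
    rw [Measure.addHaar_ball_of_pos volume x hR, finrank_euclideanSpace, Fintype.card_fin]
  have hRn : ENNReal.ofReal (R ^ n) ≠ 0 := by simp [hR]
  have hmain : (volume (Metric.ball x R))⁻¹ *
      ∫⁻ t in Ioo 0 (R ^ 2), ∫⁻ y in Metric.ball x R, ‖heat t f y‖ₑ ^ 2 ≤
      Q * (ENNReal.ofReal (φ T) * M) ^ 2 := by
    calc _ ≤ _ := mul_le_mul_right hheat _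
      _ = (ENNReal.ofReal (R ^ n))⁻¹ * ENNReal.ofReal (R ^ n) *
          (V⁻¹ * ENNReal.ofReal (Real.exp Real.pi) *
            (c ^ 2 * ENNReal.ofReal (((2 * Real.pi) ^ n)⁻¹) ^ 2) * M ^ 2 *
            (ENNReal.ofReal (R ^ 2) * gaussForm h R)) := by
        rw [hvol, ENNReal.mul_inv (Or.inl hRn) (Or.inr hV0),
          ENNReal.ofReal_mul (Real.exp_nonneg _)]
        ring
      _ ≤ V⁻¹ * ENNReal.ofReal (Real.exp Real.pi) *
            (c ^ 2 * ENNReal.ofReal (((2 * Real.pi) ^ n)⁻¹) ^ 2) * M ^ 2 *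
            (D * ENNReal.ofReal (φ T) ^ 2) := by
        rw [ENNReal.inv_mul_cancel hRn ENNReal.ofReal_ne_top, one_mul]
        exact mul_le_mul_right (hD T R hR hRT) _
      _ = (V⁻¹ * ENNReal.ofReal (Real.exp Real.pi) *
            (c ^ 2 * ENNReal.ofReal (((2 * Real.pi) ^ n)⁻¹) ^ 2) * D) *
            (ENNReal.ofReal (φ T) * M) ^ 2 := by ring
      _ ≤ _ := mul_le_mul_left le_self_add _
  calc _ ≤ (Q * (ENNReal.ofReal (φ T) * M) ^ 2) ^ (1 / 2 : ℝ) :=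
        ENNReal.rpow_le_rpow hmain (by norm_num)
    _ = _ := by
        rw [ENNReal.mul_rpow_of_nonneg _ _ (by norm_num), ← ENNReal.rpow_natCast,
          ← ENNReal.rpow_mul]
        norm_num [mul_assoc]

end Reduction

lemma majNorm_lt_top {n : ℕ} {F : Type*} [NormedAddCommGroup F] [NormedSpace ℂ F]
    {h : Rn n → ℝ≥0∞} {f : 𝓢'(Rn n, F)} (hf : f ∈ majSpace F h) : majNorm h f < ∞ := by
  obtain ⟨g, hg, hlt⟩ := hf
  exact (iInf₂_le g hg).trans_lt hlt

/-- The rate at `T = 1` gives the embedding constant, and its decay as `T → 0` gives the vanishing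
condition. -/
lemma continuouslyEmbeds_vmoSpace {n : ℕ} {F : Type*} [NormedAddCommGroup F] [NormedSpace ℂ F]
    {h : Rn n → ℝ≥0∞} {φ : ℝ → ℝ} (hφ : Tendsto φ (𝓝[>] 0) (𝓝 0))
    (hb : ∃ C : ℝ≥0, ∀ f ∈ majSpace F h, ∀ T : ℝ, 0 < T →
      bmoNorm T f ≤ C * ENNReal.ofReal (φ T) * majNorm h f) :
    ContinuouslyEmbeds (majSpace F h) (majNorm h) (vmoSpace n F) (bmoNorm 1) := by
  obtain ⟨C, hC⟩ := hb
  refine ⟨fun f hf => ⟨(hC f hf 1 one_pos).trans_lt ?_, ?_⟩, C * (φ 1).toNNReal, fun f hf => ?_⟩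
  · exact ENNReal.mul_lt_top (by finiteness) (majNorm_lt_top hf)
  · have h1 : Tendsto (fun T => C * ENNReal.ofReal (φ T) * majNorm h f) (𝓝[>] 0) (𝓝 0) := by
      have h2 : Tendsto (fun T => ENNReal.ofReal (φ T)) (𝓝[>] 0) (𝓝 0) := by
        simpa using ENNReal.tendsto_ofReal hφ
      have h3 := ENNReal.Tendsto.mul_const (ENNReal.Tendsto.const_mul h2
        (Or.inr (ENNReal.coe_ne_top (r := C)))) (Or.inr (majNorm_lt_top hf).ne)
      simpa using h3
    refine tendsto_of_tendsto_of_tendsto_of_le_of_le' tendsto_const_nhds h1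
      (Eventually.of_forall fun _ => zero_le) ?_
    filter_upwards [self_mem_nhdsWithin] with T hT using hC f hf T hT
  · simpa [ENNReal.ofReal] using hC f hf 1 one_pos

/-! ### Consequences of the convolution inequality -/

section Kernel

variable {n : ℕ} {θ α ω : ℝ} {h : Rn n → ℝ≥0∞}

lemma BehavesAlong.near_zero (hb : BehavesAlong (𝓝[≠] 0) α h) :
    ∃ (C : ℝ≥0) (r : ℝ), 0 < r ∧ ∀ ξ, ξ ≠ 0 → ‖ξ‖ < r →
      h ξ ≤ C * ENNReal.ofReal (‖ξ‖ ^ (-α)) ∧ ENNReal.ofReal (‖ξ‖ ^ (-α)) ≤ C * h ξ := by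
  obtain ⟨⟨C₁, h₁⟩, C₂, h₂⟩ := hb
  obtain ⟨r, hr, hball⟩ := Metric.eventually_nhds_iff.mp (eventually_nhdsWithin_iff.mp (h₁.and h₂))
  refine ⟨max C₁ C₂, r, hr, fun ξ hξ hlt => ?_⟩
  obtain ⟨h3, h4⟩ := hball (by simpa using hlt) hξ
  exact ⟨h3.trans (by gcongr; exact le_max_left _ _), h4.trans (by gcongr; exact le_max_right _ _)⟩

lemma BehavesAlong.near_infinity (hb : BehavesAlong (Bornology.cobounded (Rn n)) ω h) :
    ∃ (C : ℝ≥0) (ρ : ℝ), 1 ≤ ρ ∧ ∀ ξ, ρ ≤ ‖ξ‖ →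
      h ξ ≤ C * ENNReal.ofReal (‖ξ‖ ^ (-ω)) ∧ ENNReal.ofReal (‖ξ‖ ^ (-ω)) ≤ C * h ξ := by
  obtain ⟨⟨C₁, h₁⟩, C₂, h₂⟩ := hb
  obtain ⟨ρ, -, hρ⟩ := (hasBasis_cobounded_norm (E := Rn n)).eventually_iff.mp (h₁.and h₂)
  refine ⟨max C₁ C₂, max ρ 1, le_max_right _ _, fun ξ hξ => ?_⟩
  obtain ⟨h3, h4⟩ := hρ ((le_max_left _ _).trans hξ)
  exact ⟨h3.trans (by gcongr; exact le_max_left _ _), h4.trans (by gcongr; exact le_max_right _ _)⟩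

/-- The self-convolution is bounded below by restricting it to a ball. -/
lemma le_mul_selfConv {C : ℝ≥0} {d r : ℝ} {ξ z : Rn n} (hr : 0 < r)
    (h₁ : ∀ η ∈ Metric.ball z r, ENNReal.ofReal d ≤ C * h η)
    (h₂ : ∀ η ∈ Metric.ball z r, ENNReal.ofReal d ≤ C * h (ξ - η)) :
    ENNReal.ofReal d ^ 2 * (ENNReal.ofReal (r ^ n) * volume (Metric.ball (0 : Rn n) 1)) ≤
      (C : ℝ≥0∞) ^ 2 * selfConv h ξ := by
  have hvol : volume (Metric.ball z r) =
      ENNReal.ofReal (r ^ n) * volume (Metric.ball (0 : Rn n) 1) := by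
    rw [Measure.addHaar_ball_of_pos volume z hr, finrank_euclideanSpace, Fintype.card_fin]
  rw [← hvol, ← setLIntegral_const, selfConv,
    ← lintegral_const_mul' _ _ (ENNReal.pow_ne_top ENNReal.coe_ne_top)]
  refine (setLIntegral_mono' measurableSet_ball fun η hη => ?_).trans
    (setLIntegral_le_lintegral (Metric.ball z r) _)
  calc ENNReal.ofReal d ^ 2 = ENNReal.ofReal d * ENNReal.ofReal d := sq _
    _ ≤ (C * h (ξ - η)) * (C * h η) := mul_le_mul' (h₂ η hη) (h₁ η hη)
    _ = _ := by ring

/-- If `h(η)` is comparable to `|η|^{-a}` for `s/4 ≤ |η| ≤ s`, then the convolution inequality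
bounds `s^{n-a-θ}`. -/
lemma IsMajorizingKernel.rpow_le (hh : IsMajorizingKernel θ h) (hn : 0 < n) {a : ℝ} (ha : 0 ≤ a)
    (C : ℝ≥0) :
    ∃ L : ℝ, ∀ s : ℝ, 0 < s → (∀ η : Rn n, s / 4 ≤ ‖η‖ → ‖η‖ ≤ s →
      h η ≤ C * ENNReal.ofReal (‖η‖ ^ (-a)) ∧ ENNReal.ofReal (‖η‖ ^ (-a)) ≤ C * h η) →
      s ^ ((n : ℝ) - a - θ) ≤ L := by
  obtain ⟨B, hB, hconv⟩ := hh.conv_le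
  set V := volume (Metric.ball (0 : Rn n) 1) with hV
  have hV0 : 0 < V.toReal := ENNReal.toReal_pos (Metric.measure_ball_pos volume _ one_pos).ne'
    measure_ball_lt_top.ne
  refine ⟨C ^ 3 * B * 4 ^ n / V.toReal, fun s hs hcomp => ?_⟩
  -- For `|ξ| = s` and `η` within `s/4` of `ξ/2`, both `η` and `ξ - η` have norm in `[s/4, s]`.
  -- Hence `h*h(ξ)` is at least of order `s^{n-2a}`, while the right-hand side of the inequality is
  -- at most of order `s^{θ-a}`.
  set ξ : Rn n := EuclideanSpace.single ⟨0, hn⟩ s with hξ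
  have hξn : ‖ξ‖ = s := by simp [hξ, abs_of_pos hs]
  have hball : ∀ η ∈ Metric.ball ((1 / 2 : ℝ) • ξ) (s / 4), s / 4 ≤ ‖η‖ ∧ ‖η‖ ≤ s := by
    intro η hη
    have h1 : ‖η - (1 / 2 : ℝ) • ξ‖ < s / 4 := by simpa [dist_eq_norm] using hη
    have h2 : ‖(1 / 2 : ℝ) • ξ‖ = s / 2 := by rw [norm_smul, hξn]; norm_num; ring
    have h3 := abs_norm_sub_norm_le η ((1 / 2 : ℝ) • ξ)
    rw [h2] at h3
    have h4 := abs_le.mp h3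
    constructor <;> linarith [h4.1, h4.2]
  have hball' : ∀ η ∈ Metric.ball ((1 / 2 : ℝ) • ξ) (s / 4),
      ξ - η ∈ Metric.ball ((1 / 2 : ℝ) • ξ) (s / 4) := by
    intro η hη
    rw [Metric.mem_ball, dist_eq_norm] at hη ⊢
    have : ξ - η - (1 / 2 : ℝ) • ξ = -(η - (1 / 2 : ℝ) • ξ) := by module
    rwa [this, norm_neg]
  have hlow : ∀ η ∈ Metric.ball ((1 / 2 : ℝ) • ξ) (s / 4),
      ENNReal.ofReal (s ^ (-a)) ≤ C * h η := by
    intro η hη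
    obtain ⟨h1, h2⟩ := hball η hη
    refine le_trans (ENNReal.ofReal_le_ofReal ?_) (hcomp η h1 h2).2
    exact Real.rpow_le_rpow_of_nonpos (by linarith) h2 (by linarith)
  have hup : h ξ ≤ C * ENNReal.ofReal (s ^ (-a)) := by
    have := (hcomp ξ (by rw [hξn]; linarith) hξn.le).1
    rwa [hξn] at this
  have hfin : h ξ ≠ ∞ := ne_top_of_le_ne_top (by finiteness) hup
  have key := le_mul_selfConv (ξ := ξ) (by positivity) hlow (fun η hη => hlow _ (hball' η hη))
  have key2 : ENNReal.ofReal (s ^ (-a)) ^ 2 * (ENNReal.ofReal ((s / 4) ^ n) * V) ≤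
      (C : ℝ≥0∞) ^ 2 * (ENNReal.ofReal (B * s ^ θ) * (C * ENNReal.ofReal (s ^ (-a)))) := by
    refine key.trans (mul_le_mul_right ?_ _)
    have := hconv ξ hfin
    rw [hξn] at this
    exact this.trans (mul_le_mul_right hup _)
  have key3 := ENNReal.toReal_mono (by finiteness) key2
  simp only [ENNReal.toReal_mul, ENNReal.toReal_pow, ENNReal.coe_toReal] at key3
  rw [ENNReal.toReal_ofReal (by positivity), ENNReal.toReal_ofReal (by positivity),
    ENNReal.toReal_ofReal (by positivity)] at key3
  have hsa : 0 < s ^ (-a) := by positivity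
  have hsθ : 0 < s ^ θ := by positivity
  have e1 : s ^ ((n : ℝ) - a - θ) = s ^ n * s ^ (-a) / s ^ θ := by
    rw [sub_eq_add_neg (n : ℝ) a, Real.rpow_sub hs, Real.rpow_add hs, Real.rpow_natCast]
  rw [e1, div_le_div_iff₀ hsθ hV0]
  rw [div_pow] at key3
  have key4 : s ^ (-a) * (s ^ n * s ^ (-a) * V.toReal) ≤
      s ^ (-a) * (C ^ 3 * B * 4 ^ n * s ^ θ) := by
    have := mul_le_mul_of_nonneg_left key3 (by positivity : (0 : ℝ) ≤ 4 ^ n)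
    calc _ = 4 ^ n * ((s ^ (-a)) ^ 2 * (s ^ n / 4 ^ n * V.toReal)) := by field_simp
      _ ≤ _ := this
      _ = _ := by ring
  exact le_of_mul_le_mul_left key4 hsa

/-- The comparison with `|ξ|^{-α}` holds at all small scales `s`, and `s^{n-α-θ}` stays bounded as
`s → 0` only if the exponent is nonnegative. -/
lemma IsRadialMajorizingKernel.alpha_le (hh : IsRadialMajorizingKernel θ α ω h) (hn : 0 < n) :
    α ≤ n - θ := by
  obtain ⟨C, r, hr, hC⟩ := hh.at_origin.near_zero
  obtain ⟨L, hL⟩ := hh.toIsMajorizingKernel.rpow_le hn hh.alpha_nonneg C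
  by_contra! hlt
  have hlim : Tendsto (fun s : ℝ => s ^ ((n : ℝ) - α - θ)) (𝓝[>] 0) atTop :=
    tendsto_rpow_neg_nhdsGT_zero (by linarith)
  have hs : ∀ᶠ s : ℝ in 𝓝[>] 0, s < r := nhdsWithin_le_nhds (gt_mem_nhds hr)
  obtain ⟨s, ⟨h1, h2⟩, h3⟩ := ((hlim.eventually_gt_atTop L).and hs |>.and self_mem_nhdsWithin).exists
  have h0 : 0 < s := h3
  refine absurd (hL s h0 fun η h4 h5 => hC η ?_ (h5.trans_lt h2)) (not_le.mpr h1)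
  rw [← norm_pos_iff]
  linarith

/-- The same test at scales `s → ∞`, where boundedness of `s^{n-ω-θ}` requires a nonpositive
exponent. -/
lemma IsRadialMajorizingKernel.le_omega (hh : IsRadialMajorizingKernel θ α ω h) (hn : 0 < n) :
    n - θ ≤ ω := by
  obtain ⟨C, ρ, hρ, hC⟩ := hh.at_infinity.near_infinity
  obtain ⟨L, hL⟩ := hh.toIsMajorizingKernel.rpow_le hn hh.omega_pos.le C
  by_contra! hlt
  have hlim : Tendsto (fun s : ℝ => s ^ ((n : ℝ) - ω - θ)) atTop atTop :=
    tendsto_rpow_atTop (by linarith)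
  -- `s ≥ 4ρ` puts the whole shell `s/4 ≤ |η| ≤ s` in the region of comparability.
  obtain ⟨s, h1, h2⟩ := ((hlim.eventually_gt_atTop L).and (eventually_ge_atTop (4 * ρ))).exists
  exact absurd (hL s (by linarith) fun η h4 _ => hC η (by linarith)) (not_le.mpr h1)

lemma IsRadialMajorizingKernel.exists_le_of_le_norm (hh : IsRadialMajorizingKernel θ α ω h) {r : ℝ}
    (hr : 0 < r) : ∃ M : ℝ≥0, ∀ ξ, r ≤ ‖ξ‖ → h ξ ≤ M := by
  obtain ⟨M, hM⟩ := hh.bounded_away (Metric.ball 0 r) (Metric.ball_mem_nhds 0 hr)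
  exact ⟨M, fun ξ hξ => hM ξ (by simpa using hξ)⟩

/-- `h` is dominated by `|ξ|^{-(n-θ)}`. -/
lemma IsRadialMajorizingKernel.exists_le_rpow (hh : IsRadialMajorizingKernel θ α ω h) (hn : 0 < n)
    (hθ : θ ≤ n) :
    ∃ C : ℝ≥0, ∀ ξ, ξ ≠ 0 → h ξ ≤ C * ENNReal.ofReal (‖ξ‖ ^ (θ - n)) := by
  have hα := hh.alpha_le hn
  have hω := hh.le_omega hn
  obtain ⟨C₁, r, hr, h₁⟩ := hh.at_origin.near_zero
  obtain ⟨C₂, ρ, hρ, h₂⟩ := hh.at_infinity.near_infinity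
  obtain ⟨M, hM⟩ := hh.exists_le_of_le_norm (lt_min hr one_pos)
  -- On the intermediate shell `h ≤ M` and `|ξ|^{θ-n} ≥ ρ^{θ-n} = 1/κ`.
  set κ : ℝ≥0 := (ρ ^ ((n : ℝ) - θ)).toNNReal with hκ
  refine ⟨C₁ + C₂ + M * κ, fun ξ hξ => ?_⟩
  have hξ0 : 0 < ‖ξ‖ := norm_pos_iff.mpr hξ
  rcases lt_or_ge ‖ξ‖ (min r 1) with hlt | hge
  · calc h ξ ≤ C₁ * ENNReal.ofReal (‖ξ‖ ^ (-α)) := (h₁ ξ hξ (hlt.trans_le (min_le_left _ _))).1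
      _ ≤ C₁ * ENNReal.ofReal (‖ξ‖ ^ (θ - n)) := by
        refine mul_le_mul_right (ENNReal.ofReal_le_ofReal ?_) _
        exact Real.rpow_le_rpow_of_exponent_ge hξ0 (hlt.trans_le (min_le_right _ _)).le
          (by linarith)
      _ ≤ _ := by
        gcongr
        rw [add_assoc]
        exact le_self_add
  rcases le_or_gt ρ ‖ξ‖ with hge' | hlt'
  · calc h ξ ≤ C₂ * ENNReal.ofReal (‖ξ‖ ^ (-ω)) := (h₂ ξ hge').1
      _ ≤ C₂ * ENNReal.ofReal (‖ξ‖ ^ (θ - n)) := by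
        refine mul_le_mul_right (ENNReal.ofReal_le_ofReal ?_) _
        exact Real.rpow_le_rpow_of_exponent_le (hρ.trans hge') (by linarith)
      _ ≤ _ := by
        gcongr
        exact le_add_self.trans le_self_add
  · have h3 : (1 : ℝ≥0∞) ≤ κ * ENNReal.ofReal (‖ξ‖ ^ (θ - n)) := by
      rw [hκ, ← ENNReal.ofReal, ← ENNReal.ofReal_mul (by positivity), ENNReal.one_le_ofReal]
      have h4 : ρ ^ (θ - n) ≤ ‖ξ‖ ^ (θ - n) :=
        Real.rpow_le_rpow_of_nonpos hξ0 hlt'.le (by linarith)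
      have h5 : ρ ^ ((n : ℝ) - θ) * ρ ^ (θ - n) = 1 := by
        rw [← Real.rpow_add (by linarith)]; simp
      rw [← h5]
      gcongr
    calc h ξ ≤ M := hM ξ hge
      _ ≤ M * (κ * ENNReal.ofReal (‖ξ‖ ^ (θ - n))) := le_mul_of_one_le_right zero_le h3
      _ = ((M * κ : ℝ≥0) : ℝ≥0∞) * ENNReal.ofReal (‖ξ‖ ^ (θ - n)) := by
        push_cast; rw [mul_assoc]
      _ ≤ _ := by
        gcongr
        exact le_add_self

/-- `h` is bounded below by a positive constant on bounded sets. -/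
lemma IsRadialMajorizingKernel.exists_one_le_mul (hh : IsRadialMajorizingKernel θ α ω h)
    (hn : 0 < n) (ρ : ℝ) : ∃ K : ℝ≥0, ∀ ξ, ‖ξ‖ ≤ ρ → 1 ≤ K * h ξ := by
  obtain ⟨B, hB, hconv⟩ := hh.conv_le
  obtain ⟨C, σ, hσ, hC⟩ := hh.at_infinity.near_infinity
  set τ := max ρ σ with hτ
  have hτσ : σ ≤ τ := le_max_right _ _
  -- For `|ξ| ≤ τ` and `η` in the unit ball about `z`, both `η` and `ξ - η` have norm in `[σ, 5τ]`,
  -- where the decay condition bounds `h` below. So `h*h(ξ)` is bounded below, and the convolution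
  -- inequality passes this on to `h(ξ)`.
  set z : Rn n := EuclideanSpace.single ⟨0, hn⟩ (3 * τ) with hz
  have hzn : ‖z‖ = 3 * τ := by simp [hz]; linarith
  set V := volume (Metric.ball (0 : Rn n) 1) with hV
  have hV0 : V ≠ 0 := (Metric.measure_ball_pos volume _ one_pos).ne'
  have hVt : V ≠ ∞ := measure_ball_lt_top.ne
  set d : ℝ := (5 * τ) ^ (-ω) with hd
  have hd0 : 0 < d := by positivity
  set W : ℝ≥0∞ := ENNReal.ofReal d ^ 2 * (ENNReal.ofReal (1 ^ n) * V) with hW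
  have hW0 : W ≠ 0 := by simp [hW, hd0, hV0]
  have hWt : W ≠ ∞ := by finiteness
  set A : ℝ≥0∞ := (C : ℝ≥0∞) ^ 2 * ENNReal.ofReal (B * τ ^ θ) with hA
  have hAt : A ≠ ∞ := by finiteness
  have hWi : W⁻¹ ≠ ∞ := ENNReal.inv_ne_top.mpr hW0
  -- The summand 1 makes the constant nonzero, which settles the points with `h ξ = ∞`, where
  -- `conv_le` says nothing.
  refine ⟨(W⁻¹ * A + 1).toNNReal, fun ξ hξ => ?_⟩
  rw [ENNReal.coe_toNNReal (by finiteness)]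
  rcases eq_or_ne (h ξ) ∞ with htop | hfin
  · rw [htop, ENNReal.mul_top (by simp)]; exact le_top
  have hξτ : ‖ξ‖ ≤ τ := hξ.trans (le_max_left _ _)
  have hlow : ∀ η : Rn n, σ ≤ ‖η‖ → ‖η‖ ≤ 5 * τ → ENNReal.ofReal d ≤ C * h η := fun η h1 h2 =>
    (ENNReal.ofReal_le_ofReal (Real.rpow_le_rpow_of_nonpos (by linarith) h2
      (by linarith [hh.omega_pos]))).trans (hC η h1).2
  have hη : ∀ η ∈ Metric.ball z 1, 3 * τ - 1 ≤ ‖η‖ ∧ ‖η‖ ≤ 3 * τ + 1 := by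
    intro η hη
    have h1 : ‖η - z‖ < 1 := by simpa [dist_eq_norm] using hη
    have h3 := abs_le.mp (abs_norm_sub_norm_le η z)
    rw [hzn] at h3
    constructor <;> linarith [h3.1, h3.2]
  have key : W ≤ (C : ℝ≥0∞) ^ 2 * selfConv h ξ := by
    refine le_mul_selfConv (z := z) one_pos (fun η hb => ?_) (fun η hb => ?_)
    · obtain ⟨h1, h2⟩ := hη η hb
      exact hlow η (by linarith) (by linarith)
    · obtain ⟨h1, h2⟩ := hη η hb
      have h3 := norm_sub_norm_le η ξ
      have h4 := norm_sub_le ξ η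
      rw [norm_sub_rev] at h3
      exact hlow _ (by linarith) (by linarith)
  have key2 : W ≤ A * h ξ := by
    refine key.trans ?_
    rw [hA, mul_assoc]
    refine mul_le_mul_right ((hconv ξ hfin).trans (mul_le_mul_left ?_ _)) _
    refine ENNReal.ofReal_le_ofReal ?_
    gcongr
    exact hh.exponent_nonneg
  calc (1 : ℝ≥0∞) = W⁻¹ * W := (ENNReal.inv_mul_cancel hW0 hWt).symm
    _ ≤ W⁻¹ * (A * h ξ) := mul_le_mul_right key2 _
    _ = W⁻¹ * A * h ξ := (mul_assoc _ _ _).symm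
    _ ≤ _ := mul_le_mul_left le_self_add _

/-- `h` is even up to a constant. -/
lemma IsRadialMajorizingKernel.exists_neg_le (hh : IsRadialMajorizingKernel θ α ω h)
    (hn : 0 < n) : ∃ K : ℝ≥0, ∀ ξ, ξ ≠ 0 → h (-ξ) ≤ K * h ξ := by
  obtain ⟨C₁, r, hr, h₁⟩ := hh.at_origin.near_zero
  obtain ⟨C₂, ρ, hρ, h₂⟩ := hh.at_infinity.near_infinity
  obtain ⟨M, hM⟩ := hh.exists_le_of_le_norm hr
  -- Near zero and infinity evenness follows from the radial comparison; the shell in between needs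
  -- the upper bound `M` and this lower bound.
  obtain ⟨K, hK⟩ := hh.exists_one_le_mul hn ρ
  refine ⟨C₁ * C₁ + C₂ * C₂ + M * K, fun ξ hξ => ?_⟩
  rcases lt_or_ge ‖ξ‖ r with hlt | hge
  · have h3 := (h₁ (-ξ) (neg_ne_zero.mpr hξ) (by rwa [norm_neg])).1
    rw [norm_neg] at h3
    calc h (-ξ) ≤ C₁ * (C₁ * h ξ) := h3.trans (mul_le_mul_right (h₁ ξ hξ hlt).2 _)
      _ = ((C₁ * C₁ : ℝ≥0) : ℝ≥0∞) * h ξ := by push_cast; rw [mul_assoc]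
      _ ≤ _ := by
        gcongr
        rw [add_assoc]
        exact le_self_add
  rcases le_or_gt ρ ‖ξ‖ with hge' | hlt'
  · have h3 := (h₂ (-ξ) (by rwa [norm_neg])).1
    rw [norm_neg] at h3
    calc h (-ξ) ≤ C₂ * (C₂ * h ξ) := h3.trans (mul_le_mul_right (h₂ ξ hge').2 _)
      _ = ((C₂ * C₂ : ℝ≥0) : ℝ≥0∞) * h ξ := by push_cast; rw [mul_assoc]
      _ ≤ _ := by
        gcongr
        exact le_add_self.trans le_self_add
  · calc h (-ξ) ≤ M := hM _ (by rwa [norm_neg])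
      _ ≤ M * (K * h ξ) := le_mul_of_one_le_right zero_le (hK ξ hlt'.le)
      _ = ((M * K : ℝ≥0) : ℝ≥0∞) * h ξ := by push_cast; rw [mul_assoc]
      _ ≤ _ := by
        gcongr
        exact le_add_self

/-- Local integrability is part of `IsFunction`, and `h` agrees almost everywhere with its
real-valued version. -/
lemma IsMajorizingKernel.lintegral_ball_lt_top (hh : IsMajorizingKernel θ h) (r : ℝ) :
    ∫⁻ ξ in Metric.ball 0 r, h ξ < ∞ := by
  obtain ⟨u, hu, -⟩ := hh.tempered
  have h1 := (hu.integrableOn_isCompact (isCompact_closedBall (0 : Rn n) r)).2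
  refine lt_of_le_of_lt ?_ h1
  have hfin : ∀ᵐ ξ, h ξ ≠ ∞ := by
    rw [ae_iff]; simpa using hh.finite_ae
  refine (lintegral_mono_set Metric.ball_subset_closedBall).trans
    (lintegral_mono_ae (ae_restrict_of_ae ?_))
  filter_upwards [hfin] with ξ hξ
  rw [← ofReal_norm, Complex.norm_real, Real.norm_of_nonneg ENNReal.toReal_nonneg,
    ENNReal.ofReal_toReal hξ]

end Kernel

/-! ### Radial integrals -/

lemma rpow_neg_le_mul_one_add_norm {n : ℕ} {s : ℝ} (hs : 0 ≤ s) {ξ : Rn n} (hξ : 1 ≤ ‖ξ‖) :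
    ‖ξ‖ ^ (-s) ≤ 2 ^ s * (1 + ‖ξ‖) ^ (-s) := by
  have h1 : (0 : ℝ) < ‖ξ‖ := by linarith
  have h2 : (2 * ‖ξ‖) ^ (-s) ≤ (1 + ‖ξ‖) ^ (-s) :=
    Real.rpow_le_rpow_of_nonpos (by positivity) (by linarith) (by linarith)
  calc ‖ξ‖ ^ (-s) = 2 ^ s * (2 * ‖ξ‖) ^ (-s) := by
        rw [Real.mul_rpow (by norm_num) h1.le, ← mul_assoc, ← Real.rpow_add (by norm_num)]
        simp
    _ ≤ _ := by gcongr

lemma lintegral_rpow_neg_compl_ball_lt_top {n : ℕ} {s : ℝ} (hs : n < s) :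
    ∫⁻ ξ in (Metric.ball (0 : Rn n) 1)ᶜ, ENNReal.ofReal (‖ξ‖ ^ (-s)) < ∞ := by
  have hs0 : 0 ≤ s := n.cast_nonneg.trans hs.le
  have hfin : ∫⁻ ξ : Rn n, ENNReal.ofReal ((1 + ‖ξ‖) ^ (-s)) < ∞ :=
    finite_integral_one_add_norm (by simpa using hs)
  calc _ ≤ ∫⁻ ξ in (Metric.ball (0 : Rn n) 1)ᶜ,
          ENNReal.ofReal (2 ^ s) * ENNReal.ofReal ((1 + ‖ξ‖) ^ (-s)) := by
        refine setLIntegral_mono' measurableSet_ball.compl fun ξ hξ => ?_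
        rw [← ENNReal.ofReal_mul (by positivity)]
        exact ENNReal.ofReal_le_ofReal (rpow_neg_le_mul_one_add_norm hs0 (by simpa using hξ))
    _ ≤ ∫⁻ ξ : Rn n, ENNReal.ofReal (2 ^ s) * ENNReal.ofReal ((1 + ‖ξ‖) ^ (-s)) :=
        setLIntegral_le_lintegral _ _
    _ = ENNReal.ofReal (2 ^ s) * ∫⁻ ξ : Rn n, ENNReal.ofReal ((1 + ‖ξ‖) ^ (-s)) :=
        lintegral_const_mul' _ _ ENNReal.ofReal_ne_top
    _ < ∞ := ENNReal.mul_lt_top ENNReal.ofReal_lt_top hfin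

/-- In polar coordinates the integrand is `y^{θ-1}`, integrable at zero because `θ > 0`. -/
lemma lintegral_rpow_ball_lt_top {n : ℕ} (hn : 0 < n) {θ : ℝ} (hθ : 0 < θ) :
    ∫⁻ ξ in Metric.ball (0 : Rn n) 1, ENNReal.ofReal (‖ξ‖ ^ (θ - n)) < ∞ := by
  have : Nonempty (Fin n) := ⟨⟨0, hn⟩⟩
  have h1 : IntegrableOn (fun ξ : Rn n => ‖ξ‖ ^ (θ - n)) (Metric.ball 0 1) volume := by
    rw [integrableOn_fun_norm_addHaar volume (f := fun y : ℝ => y ^ (θ - n)),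
      finrank_euclideanSpace, Fintype.card_fin]
    refine (((intervalIntegral.integrableOn_Ioo_rpow_iff one_pos).mpr
      (by linarith : -1 < θ - 1))).congr_fun (fun y hy => ?_) measurableSet_Ioo
    simp only [smul_eq_mul]
    rw [← Real.rpow_natCast, ← Real.rpow_add hy.1, Nat.cast_sub hn]
    congr 1
    push_cast
    ring
  have := h1.2
  rw [hasFiniteIntegral_iff_ofReal (ae_of_all _ fun ξ => by positivity)] at this
  exact this

/-- Radial integration for nonnegative functions. -/
lemma lintegral_ofReal_norm {n : ℕ} (hn : 0 < n) {f k : ℝ → ℝ} (hf : ∀ y, 0 ≤ f y)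
    (hfk : ∀ y, 0 < y → y ^ (n - 1) * f y = k y) (hk : IntegrableOn k (Ioi 0)) :
    ∫⁻ ξ : Rn n, ENNReal.ofReal (f ‖ξ‖) =
      ENNReal.ofReal (n * volume.real (Metric.ball (0 : Rn n) 1) * ∫ y in Ioi 0, k y) := by
  have : Nonempty (Fin n) := ⟨⟨0, hn⟩⟩
  have hcongr : ∫ y in Ioi (0 : ℝ), y ^ (n - 1) • f y = ∫ y in Ioi 0, k y :=
    setIntegral_congr_fun measurableSet_Ioi fun y hy => hfk y hy
  have h1 : Integrable (fun ξ : Rn n => f ‖ξ‖) volume := by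
    rw [integrable_fun_norm_addHaar, finrank_euclideanSpace, Fintype.card_fin]
    exact hk.congr_fun (fun y hy => (hfk y hy).symm) measurableSet_Ioi
  rw [← ofReal_integral_eq_lintegral_ofReal h1 (ae_of_all _ fun ξ => hf _),
    integral_fun_norm_addHaar, finrank_euclideanSpace, Fintype.card_fin, hcongr, nsmul_eq_mul,
    smul_eq_mul, mul_assoc]

lemma lintegral_inv_pow_norm_Icc {n : ℕ} (hn : 0 < n) {N : ℝ} (hN : 1 ≤ N) :
    ∫⁻ ξ : Rn n, ENNReal.ofReal ((Icc 1 N).indicator (fun y : ℝ => y ^ (-(n : ℝ))) ‖ξ‖) =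
      ENNReal.ofReal (n * volume.real (Metric.ball (0 : Rn n) 1) * Real.log N) := by
  have h0 : (0 : ℝ) ∉ uIcc 1 N := by
    rw [uIcc_of_le hN]; exact fun h => absurd h.1 (by norm_num)
  have hint : IntegrableOn (fun y : ℝ => y⁻¹) (Icc 1 N) := by
    rw [← intervalIntegrable_iff_integrableOn_Icc_of_le hN]
    exact intervalIntegrable_inv_iff.mpr (Or.inr h0)
  rw [lintegral_ofReal_norm hn (f := (Icc 1 N).indicator fun y => y ^ (-(n : ℝ)))
    (k := (Icc 1 N).indicator fun y => y⁻¹)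
    (fun y => indicator_nonneg (fun y hy => Real.rpow_nonneg (by linarith [hy.1]) _) y)]
  · congr 2
    rw [setIntegral_indicator measurableSet_Icc,
      inter_eq_right.mpr (show Icc 1 N ⊆ Ioi 0 from fun y hy => lt_of_lt_of_le one_pos hy.1),
      integral_Icc_eq_integral_Ioc,
      ← intervalIntegral.integral_of_le hN, integral_inv h0, div_one]
  · intro y hy
    by_cases hm : y ∈ Icc 1 N
    · rw [indicator_of_mem hm, indicator_of_mem hm, Real.rpow_neg hy.le, Real.rpow_natCast]
      obtain ⟨k, rfl⟩ : ∃ k, n = k + 1 := ⟨n - 1, by omega⟩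
      rw [Nat.add_sub_cancel, pow_succ]
      field_simp
    · rw [indicator_of_notMem hm, indicator_of_notMem hm, mul_zero]
  · exact (hint.integrable_indicator measurableSet_Icc).integrableOn

lemma lintegral_inv_pow_norm_Ioi {n : ℕ} (hn : 0 < n) {N : ℝ} (hN : 1 ≤ N) :
    ∫⁻ ξ : Rn n, ENNReal.ofReal ((Ioi N).indicator (fun y : ℝ => y ^ (-(n : ℝ) - 2)) ‖ξ‖) =
      ENNReal.ofReal (n * volume.real (Metric.ball (0 : Rn n) 1) * (N ^ (-2 : ℝ) / 2)) := by
  have hN0 : 0 < N := by linarith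
  rw [lintegral_ofReal_norm hn (f := (Ioi N).indicator fun y => y ^ (-(n : ℝ) - 2))
    (k := (Ioi N).indicator fun y => y ^ (-3 : ℝ))
    (fun y => indicator_nonneg (fun y hy => Real.rpow_nonneg (hN0.trans hy).le _) y)]
  · congr 2
    rw [setIntegral_indicator measurableSet_Ioi,
      inter_eq_right.mpr (Ioi_subset_Ioi hN0.le), integral_Ioi_rpow_of_lt (by norm_num) hN0]
    norm_num
  · intro y hy
    by_cases hm : y ∈ Ioi N
    · rw [indicator_of_mem hm, indicator_of_mem hm, ← Real.rpow_natCast, ← Real.rpow_add hy,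
        Nat.cast_sub hn]
      congr 1
      push_cast
      ring
    · rw [indicator_of_notMem hm, indicator_of_notMem hm, mul_zero]
  · exact ((integrableOn_Ioi_rpow_of_lt (by norm_num) hN0).integrable_indicator
      measurableSet_Ioi).integrableOn

/-- Split at `N = max(1, 1/R)`. Up to `N` the Gaussian is bounded by 1 and the integral is a
multiple of `log N = log₊(1/R)`. Beyond `N`, `e^{-u} ≤ 1/u` gains two powers of decay, and the tail
is of order `(RN)^{-2} ≤ 1`. -/
lemma exists_lintegral_inv_pow_mul_gaussian_le {n : ℕ} (hn : 0 < n) :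
    ∃ C : ℝ≥0, ∀ R : ℝ, 0 < R →
      ∫⁻ ξ in (Metric.ball (0 : Rn n) 1)ᶜ, ENNReal.ofReal (‖ξ‖ ^ (-(n : ℝ))) *
        ENNReal.ofReal (Real.exp (-(R ^ 2 * ‖ξ‖ ^ 2 / (4 * Real.pi)))) ≤
      C * ENNReal.ofReal (1 + Real.posLog R⁻¹) := by
  set v := n * volume.real (Metric.ball (0 : Rn n) 1) with hv
  have hv0 : 0 ≤ v := by positivity
  refine ⟨(v * (2 * Real.pi + 1)).toNNReal, fun R hR => ?_⟩
  set N := max 1 R⁻¹ with hN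
  have hN1 : 1 ≤ N := le_max_left _ _
  have hN0 : 0 < N := by linarith
  have hRN : 1 ≤ R * N := by
    calc (1 : ℝ) = R * R⁻¹ := (mul_inv_cancel₀ hR.ne').symm
      _ ≤ R * N := by gcongr; exact le_max_right _ _
  have hlog : Real.log N = Real.posLog R⁻¹ := by
    have := Real.posLog_eq_log_max_one (x := R⁻¹) (by positivity)
    rw [this]
  have hpl : 0 ≤ Real.posLog R⁻¹ := Real.posLog_nonneg
  have hpt : ∀ ξ ∈ (Metric.ball (0 : Rn n) 1)ᶜ, ENNReal.ofReal (‖ξ‖ ^ (-(n : ℝ))) *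
        ENNReal.ofReal (Real.exp (-(R ^ 2 * ‖ξ‖ ^ 2 / (4 * Real.pi)))) ≤
      ENNReal.ofReal ((Icc 1 N).indicator (fun y : ℝ => y ^ (-(n : ℝ))) ‖ξ‖) +
        ENNReal.ofReal (4 * Real.pi / R ^ 2) *
          ENNReal.ofReal ((Ioi N).indicator (fun y : ℝ => y ^ (-(n : ℝ) - 2)) ‖ξ‖) := by
    intro ξ hξ
    have h1 : 1 ≤ ‖ξ‖ := by simpa using hξ
    have h0 : 0 < ‖ξ‖ := by linarith
    rcases le_or_gt ‖ξ‖ N with hle | hgt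
    · rw [indicator_of_mem (show ‖ξ‖ ∈ Icc 1 N from ⟨h1, hle⟩)]
      refine le_trans (mul_le_of_le_one_right' ?_) le_self_add
      rw [ENNReal.ofReal_le_one, Real.exp_le_one_iff]
      have : 0 ≤ R ^ 2 * ‖ξ‖ ^ 2 / (4 * Real.pi) := by positivity
      linarith
    · rw [indicator_of_mem (show ‖ξ‖ ∈ Ioi N from hgt)]
      refine le_trans ?_ le_add_self
      rw [← ENNReal.ofReal_mul (by positivity), ← ENNReal.ofReal_mul (by positivity)]
      refine ENNReal.ofReal_le_ofReal ?_
      set u := R ^ 2 * ‖ξ‖ ^ 2 / (4 * Real.pi) with hu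
      have hu0 : 0 < u := by positivity
      have h2 : Real.exp (-u) ≤ 1 / u := by
        rw [Real.exp_neg, ← one_div]
        exact one_div_le_one_div_of_le hu0 (by linarith [Real.add_one_le_exp u])
      calc ‖ξ‖ ^ (-(n : ℝ)) * Real.exp (-u) ≤ ‖ξ‖ ^ (-(n : ℝ)) * (1 / u) := by gcongr
        _ = 4 * Real.pi / R ^ 2 * ‖ξ‖ ^ (-(n : ℝ) - 2) := by
          rw [Real.rpow_sub h0, Real.rpow_two, hu]
          field_simp
  have hm1 : Measurable fun ξ : Rn n =>
      ENNReal.ofReal ((Icc 1 N).indicator (fun y : ℝ => y ^ (-(n : ℝ))) ‖ξ‖) :=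
    ENNReal.measurable_ofReal.comp (((measurable_id.pow_const _).indicator measurableSet_Icc).comp
      measurable_norm)
  calc _ ≤ _ := setLIntegral_mono' measurableSet_ball.compl hpt
    _ ≤ _ := setLIntegral_le_lintegral _ _
    _ = ENNReal.ofReal (v * Real.log N) +
        ENNReal.ofReal (4 * Real.pi / R ^ 2) * ENNReal.ofReal (v * (N ^ (-2 : ℝ) / 2)) := by
      rw [lintegral_add_left hm1, lintegral_const_mul' _ _ ENNReal.ofReal_ne_top,
        lintegral_inv_pow_norm_Icc hn hN1, lintegral_inv_pow_norm_Ioi hn hN1]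
    _ ≤ _ := by
      rw [← ENNReal.ofReal, ← ENNReal.ofReal_mul (by positivity),
        ← ENNReal.ofReal_mul (by positivity), hlog,
        ← ENNReal.ofReal_add (by positivity) (by positivity)]
      refine ENNReal.ofReal_le_ofReal ?_
      have h3 : 4 * Real.pi / R ^ 2 * (v * (N ^ (-2 : ℝ) / 2)) =
          2 * Real.pi * v * (1 / (R * N) ^ 2) := by
        rw [Real.rpow_neg hN0.le, Real.rpow_two]
        field_simp
        ring
      have h4 : 1 / (R * N) ^ 2 ≤ 1 := by
        rw [div_le_one (by positivity)]
        exact one_le_pow₀ hRN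
      have h5 : 2 * Real.pi * v * (1 / (R * N) ^ 2) ≤ 2 * Real.pi * v * 1 := by gcongr
      have h6 : 0 ≤ v * (2 * Real.pi) * Real.posLog R⁻¹ := by positivity
      rw [h3]
      nlinarith

/-! ### Bounds for the quadratic form -/

section Form

variable {n : ℕ} {θ α ω : ℝ} {h : Rn n → ℝ≥0∞}

lemma ofReal_exp_neg_le_one {s : ℝ} (hs : 0 ≤ s) : ENNReal.ofReal (Real.exp (-s)) ≤ 1 := by
  rw [ENNReal.ofReal_le_one, Real.exp_le_one_iff]
  linarith

lemma gaussForm_le_sq_lintegral (hm : AEMeasurable h volume) (R : ℝ) :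
    gaussForm h R ≤ (∫⁻ ξ, h ξ) ^ 2 := by
  calc gaussForm h R ≤ ∫⁻ ξ, ∫⁻ η, h ξ * h η :=
        lintegral_mono fun ξ => lintegral_mono fun η =>
          mul_le_of_le_one_right' (ofReal_exp_neg_le_one (by positivity))
    _ = _ := by
        simp only [lintegral_const_mul'' _ hm]
        rw [lintegral_mul_const'' _ hm, sq]

/-! ### The homogeneous majorant, for `0 < θ < 1` -/

lemma lintegral_gaussian_lt_top (n : ℕ) :
    ∫⁻ ξ : Rn n, ENNReal.ofReal (Real.exp (-(1 ^ 2 * ‖ξ‖ ^ 2 / (4 * Real.pi)))) < ∞ := by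
  have h1 : HasFiniteIntegral (fun ξ : Rn n => Real.exp (-(1 / (4 * Real.pi)) * ‖ξ‖ ^ 2)) volume :=
    ((gaussian n (1 / (4 * Real.pi)) (by positivity)).integrable (μ := volume)).2
  rw [hasFiniteIntegral_iff_ofReal (ae_of_all _ fun ξ => Real.exp_nonneg _)] at h1
  refine lt_of_le_of_lt (le_of_eq (lintegral_congr fun ξ => ?_)) h1
  congr 2
  ring

/-- Near the origin `|ξ|^{θ-n}` is integrable because `θ > 0`. Far out the product is at most the
larger square, the Gaussian integrates one variable, and the square is integrable in the other
because `2(n-θ) > n`; this is where `n ≥ 2` and `θ < 1` enter. -/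
lemma gaussForm_rpow_one_lt_top (hn : 2 ≤ n) (hθ : 0 < θ) (hθ1 : θ < 1) :
    gaussForm (fun ξ : Rn n => ENNReal.ofReal (‖ξ‖ ^ (θ - n))) 1 < ∞ := by
  have hn2 : (2 : ℝ) ≤ n := by exact_mod_cast hn
  set a : Rn n → ℝ≥0∞ := fun ξ => ENNReal.ofReal (‖ξ‖ ^ (θ - n)) with ha
  set E : Rn n → ℝ≥0∞ := fun ξ =>
    ENNReal.ofReal (Real.exp (-(1 ^ 2 * ‖ξ‖ ^ 2 / (4 * Real.pi)))) with hE
  set S := Metric.ball (0 : Rn n) 1 with hS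
  have hSm : MeasurableSet S := measurableSet_ball
  have ham : Measurable a :=
    ENNReal.measurable_ofReal.comp (measurable_norm.pow_const _)
  have hEm : Measurable E := (ENNReal.continuous_ofReal.comp (by fun_prop)).measurable
  have hE1 : ∀ ξ, E ξ ≤ 1 := fun ξ => ofReal_exp_neg_le_one (by positivity)
  have ha1 : ∀ ξ ∉ S, a ξ ≤ 1 := fun ξ hξ => by
    rw [ha, ENNReal.ofReal_le_one]
    exact Real.rpow_le_one_of_one_le_of_nonpos (by simpa [hS] using hξ) (by linarith)
  set b : Rn n → ℝ≥0∞ := fun ξ => S.indicator a ξ + Sᶜ.indicator (fun ξ => a ξ ^ 2) ξ with hb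
  have hbm : Measurable b :=
    (ham.indicator hSm).add ((ham.pow_const 2).indicator hSm.compl)
  have hL : ∫⁻ ξ, S.indicator a ξ < ∞ := by
    rw [lintegral_indicator hSm]
    exact lintegral_rpow_ball_lt_top (by omega) hθ
  have hβ : ∫⁻ ξ, b ξ < ∞ := by
    rw [hb, lintegral_add_left (ham.indicator hSm), lintegral_indicator hSm.compl]
    refine ENNReal.add_lt_top.mpr ⟨hL, ?_⟩
    have := lintegral_rpow_neg_compl_ball_lt_top (n := n) (s := 2 * (n - θ)) (by linarith)
    refine lt_of_le_of_lt (le_of_eq (lintegral_congr fun ξ => ?_)) this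
    rw [ha, ← ENNReal.ofReal_pow (by positivity), ← Real.rpow_natCast,
      ← Real.rpow_mul (norm_nonneg _)]
    congr 2
    push_cast
    ring
  -- If exactly one variable lies in the unit ball, the factor of the other is at most 1; if both
  -- lie outside, the larger of the two is squared.
  have hpt : ∀ ξ η, a ξ * a η * E (ξ - η) ≤
      S.indicator a ξ * S.indicator a η + b ξ * E (ξ - η) + b η * E (ξ - η) := by
    intro ξ η
    by_cases h1 : ξ ∈ S <;> by_cases h2 : η ∈ S
    · rw [indicator_of_mem h1, indicator_of_mem h2, add_assoc]
      exact (mul_le_of_le_one_right' (hE1 _)).trans le_self_add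
    · have hbξ : b ξ = a ξ := by simp [hb, h1]
      rw [hbξ]
      calc _ ≤ a ξ * E (ξ - η) := mul_le_mul_left (mul_le_of_le_one_right' (ha1 η h2)) _
        _ ≤ _ := le_add_self.trans le_self_add
    · have hbη : b η = a η := by simp [hb, h2]
      rw [hbη]
      calc _ ≤ a η * E (ξ - η) := mul_le_mul_left (mul_le_of_le_one_left' (ha1 ξ h1)) _
        _ ≤ _ := le_add_self
    · have hbξ : b ξ = a ξ ^ 2 := by simp [hb, h1]
      have hbη : b η = a η ^ 2 := by simp [hb, h2]
      rw [hbξ, hbη, sq, sq]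
      rcases le_total (a ξ) (a η) with hle | hle
      · exact (mul_le_mul_left (mul_le_mul_left hle _) _).trans le_add_self
      · exact (mul_le_mul_left (mul_le_mul_right hle _) _).trans (le_add_self.trans le_self_add)
  have hsubm : Measurable fun p : Rn n × Rn n => E (p.1 - p.2) :=
    hEm.comp (measurable_fst.sub measurable_snd)
  have hEint : ∀ ξ, ∫⁻ η, E (ξ - η) = ∫⁻ η, E η := fun ξ => lintegral_sub_left_eq_self E ξ
  have hEint' : ∀ η, ∫⁻ ξ, E (ξ - η) = ∫⁻ ξ, E ξ := fun η => lintegral_sub_right_eq_self E η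
  have hEfin : ∫⁻ η, E η < ∞ := lintegral_gaussian_lt_top n
  have hsub1 : ∀ ξ, Measurable fun η => E (ξ - η) := fun ξ => hEm.comp (measurable_const.sub measurable_id)
  have hsub2 : ∀ η, Measurable fun ξ => E (ξ - η) := fun η => hEm.comp (measurable_id.sub measurable_const)
  have hI1 : ∫⁻ ξ, ∫⁻ η, S.indicator a ξ * S.indicator a η =
      (∫⁻ ξ, S.indicator a ξ) * ∫⁻ ξ, S.indicator a ξ := by
    simp only [lintegral_const_mul _ (ham.indicator hSm)]
    rw [lintegral_mul_const _ (ham.indicator hSm)]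
  have hI2 : ∫⁻ ξ, ∫⁻ η, b ξ * E (ξ - η) = (∫⁻ ξ, b ξ) * ∫⁻ η, E η := by
    simp only [lintegral_const_mul _ (hsub1 _), hEint]
    rw [lintegral_mul_const _ hbm]
  have hI3 : ∫⁻ ξ, ∫⁻ η, b η * E (ξ - η) = (∫⁻ ξ, b ξ) * ∫⁻ η, E η := by
    rw [lintegral_lintegral_swap ((hbm.comp measurable_snd).mul hsubm).aemeasurable]
    simp only [lintegral_const_mul _ (hsub2 _), hEint']
    rw [lintegral_mul_const _ hbm]
  calc gaussForm a 1 = ∫⁻ ξ, ∫⁻ η, a ξ * a η * E (ξ - η) := rfl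
    _ ≤ ∫⁻ ξ, ∫⁻ η, (S.indicator a ξ * S.indicator a η + b ξ * E (ξ - η) + b η * E (ξ - η)) :=
        lintegral_mono fun ξ => lintegral_mono fun η => hpt ξ η
    _ = (∫⁻ ξ, S.indicator a ξ) * (∫⁻ ξ, S.indicator a ξ) + (∫⁻ ξ, b ξ) * (∫⁻ η, E η) +
        (∫⁻ ξ, b ξ) * ∫⁻ η, E η := by
      have hma : Measurable (Function.uncurry fun ξ η : Rn n => S.indicator a ξ * S.indicator a η) :=
        ((ham.indicator hSm).comp measurable_fst).mul ((ham.indicator hSm).comp measurable_snd)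
      have hmb : Measurable (Function.uncurry fun ξ η : Rn n => b ξ * E (ξ - η)) :=
        (hbm.comp measurable_fst).mul hsubm
      have h1 : ∀ ξ, ∫⁻ η, (S.indicator a ξ * S.indicator a η + b ξ * E (ξ - η) + b η * E (ξ - η)) =
          (∫⁻ η, S.indicator a ξ * S.indicator a η) + (∫⁻ η, b ξ * E (ξ - η)) +
            ∫⁻ η, b η * E (ξ - η) := fun ξ => by
        rw [lintegral_add_left, lintegral_add_left]
        · exact (ham.indicator hSm).const_mul _
        · exact ((ham.indicator hSm).const_mul _).add ((hsub1 ξ).const_mul _)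
      simp only [h1]
      rw [lintegral_add_left, lintegral_add_left, hI1, hI2, hI3]
      · exact hma.lintegral_prod_right'
      · exact hma.lintegral_prod_right'.add hmb.lintegral_prod_right'
    _ < ∞ := by finiteness

/-- Homogeneity of degree `θ - n` in each variable against the two Jacobians: `R^{2(n-θ)} R^{-2n} =
R^{-2θ}`. -/
lemma gaussForm_rpow {R : ℝ} (hR : 0 < R) :
    gaussForm (fun ξ : Rn n => ENNReal.ofReal (‖ξ‖ ^ (θ - n))) R =
      ENNReal.ofReal (R ^ (-θ)) ^ 2 *
        gaussForm (fun ξ : Rn n => ENNReal.ofReal (‖ξ‖ ^ (θ - n))) 1 := by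
  set a : Rn n → ℝ≥0∞ := fun ξ => ENNReal.ofReal (‖ξ‖ ^ (θ - n)) with ha
  have h1 := gaussForm_comp_const_smul a hR 1
  rw [mul_one] at h1
  have h2 : gaussForm (fun ξ => a (R • ξ)) R = ENNReal.ofReal (R ^ (θ - n)) ^ 2 * gaussForm a R := by
    have h3 : ∀ ξ, a (R • ξ) = ENNReal.ofReal (R ^ (θ - n)) * a ξ := fun ξ => by
      simp only [ha]
      rw [norm_smul, Real.norm_of_nonneg hR.le, Real.mul_rpow hR.le (norm_nonneg _),
        ENNReal.ofReal_mul (by positivity)]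
    simp only [gaussForm, h3]
    rw [← lintegral_const_mul' _ _ (by finiteness)]
    refine lintegral_congr fun ξ => ?_
    rw [← lintegral_const_mul' _ _ (by finiteness)]
    exact lintegral_congr fun η => by ring
  rw [h2] at h1
  have h4 : ENNReal.ofReal (R ^ (n - θ)) ^ 2 * ENNReal.ofReal (R ^ (θ - n)) ^ 2 = 1 := by
    rw [← mul_pow, ← ENNReal.ofReal_mul (by positivity), ← Real.rpow_add hR]
    simp
  have h5 : ENNReal.ofReal (R ^ (n - θ)) ^ 2 * ENNReal.ofReal ((R ^ n)⁻¹) ^ 2 =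
      ENNReal.ofReal (R ^ (-θ)) ^ 2 := by
    rw [← mul_pow, ← ENNReal.ofReal_mul (by positivity), ← Real.rpow_natCast, ← Real.rpow_neg hR.le,
      ← Real.rpow_add hR]
    congr 3
    ring
  calc gaussForm a R = ENNReal.ofReal (R ^ (n - θ)) ^ 2 *
        (ENNReal.ofReal (R ^ (θ - n)) ^ 2 * gaussForm a R) := by rw [← mul_assoc, h4, one_mul]
    _ = _ := by rw [h1, ← mul_assoc, h5]

lemma ae_ne_zero (hn : 0 < n) : ∀ᵐ ξ : Rn n, ξ ≠ 0 := by
  have : Nonempty (Fin n) := ⟨⟨0, hn⟩⟩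
  exact Measure.ae_ne volume 0

lemma IsRadialMajorizingKernel.exists_gaussForm_le_rpow (hh : IsRadialMajorizingKernel θ α ω h)
    (hn : 2 ≤ n) (hθ : 0 < θ) (hθ1 : θ < 1) :
    ∃ C : ℝ≥0, ∀ R : ℝ, 0 < R → gaussForm h R ≤ C * ENNReal.ofReal (R ^ (-θ)) ^ 2 := by
  have hθn : θ ≤ n := hθ1.le.trans (by exact_mod_cast (by omega : 1 ≤ n))
  obtain ⟨C, hC⟩ := hh.exists_le_rpow (by omega) hθn
  have hfin := gaussForm_rpow_one_lt_top (n := n) hn hθ hθ1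
  refine ⟨C ^ 2 * (gaussForm (fun ξ : Rn n => ENNReal.ofReal (‖ξ‖ ^ (θ - n))) 1).toNNReal,
    fun R hR => ?_⟩
  push_cast
  rw [ENNReal.coe_toNNReal hfin.ne, mul_assoc, mul_comm (gaussForm _ 1), ← gaussForm_rpow hR,
    gaussForm, gaussForm, ← lintegral_const_mul' _ _ (by finiteness)]
  refine lintegral_mono_ae ?_
  filter_upwards [ae_ne_zero (by omega : 0 < n)] with ξ hξ
  rw [← lintegral_const_mul' _ _ (by finiteness)]
  refine lintegral_mono_ae ?_
  filter_upwards [ae_ne_zero (by omega : 0 < n)] with η hη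
  calc _ ≤ (C * ENNReal.ofReal (‖ξ‖ ^ (θ - n))) * (C * ENNReal.ofReal (‖η‖ ^ (θ - n))) * _ :=
        mul_le_mul_left (mul_le_mul' (hC ξ hξ) (hC η hη)) _
    _ = _ := by ring

/-! ### Integrability and the logarithmic borderline, for `θ = 0` -/

lemma IsRadialMajorizingKernel.lintegral_lt_top (hh : IsRadialMajorizingKernel θ α ω h)
    (hω : n < ω) : ∫⁻ ξ, h ξ < ∞ := by
  obtain ⟨C, ρ, hρ, hC⟩ := hh.at_infinity.near_infinity
  rw [← lintegral_add_compl h (measurableSet_ball (x := (0 : Rn n)) (ε := ρ))]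
  refine ENNReal.add_lt_top.mpr ⟨hh.lintegral_ball_lt_top ρ, ?_⟩
  calc _ ≤ ∫⁻ ξ in (Metric.ball (0 : Rn n) ρ)ᶜ, C * ENNReal.ofReal (‖ξ‖ ^ (-ω)) :=
        setLIntegral_mono' measurableSet_ball.compl fun ξ hξ => (hC ξ (by simpa using hξ)).1
    _ ≤ ∫⁻ ξ in (Metric.ball (0 : Rn n) 1)ᶜ, C * ENNReal.ofReal (‖ξ‖ ^ (-ω)) :=
        lintegral_mono_set (compl_subset_compl.mpr (Metric.ball_subset_ball hρ))
    _ = C * ∫⁻ ξ in (Metric.ball (0 : Rn n) 1)ᶜ, ENNReal.ofReal (‖ξ‖ ^ (-ω)) :=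
        lintegral_const_mul' _ _ ENNReal.coe_ne_top
    _ < ∞ := ENNReal.mul_lt_top ENNReal.coe_lt_top (lintegral_rpow_neg_compl_ball_lt_top hω)

/-- For `θ = 0` the convolution inequality reduces the quadratic form to a single integral. -/
lemma IsRadialMajorizingKernel.exists_gaussForm_le_lintegral
    (hh : IsRadialMajorizingKernel 0 α ω h) (hn : 0 < n) :
    ∃ C : ℝ≥0, ∀ R : ℝ, gaussForm h R ≤
      C * ∫⁻ ζ, h ζ * ENNReal.ofReal (Real.exp (-(R ^ 2 * ‖ζ‖ ^ 2 / (4 * Real.pi)))) := by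
  obtain ⟨K, hK⟩ := hh.exists_neg_le hn
  obtain ⟨B, hB, hconv⟩ := hh.conv_le
  refine ⟨K * B.toNNReal, fun R => ?_⟩
  set E : Rn n → ℝ≥0∞ := fun ξ =>
    ENNReal.ofReal (Real.exp (-(R ^ 2 * ‖ξ‖ ^ 2 / (4 * Real.pi)))) with hE
  have hEm : Measurable E := (ENNReal.continuous_ofReal.comp (by fun_prop)).measurable
  have hm := hh.aemeasurable
  have hfin : ∀ᵐ ξ, h ξ ≠ ∞ := by
    rw [ae_iff]; simpa using hh.finite_ae
  have hmeas : AEMeasurable (Function.uncurry fun ζ η : Rn n => h (ζ - η) * h η * E ζ)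
      (volume.prod volume) := by
    refine ((AEMeasurable.comp_quasiMeasurePreserving (g := h) hm ?_).mul ?_).mul ?_
    · exact quasiMeasurePreserving_sub_of_right_invariant volume volume
    · exact hm.comp_snd
    · exact (hEm.comp measurable_fst).aemeasurable
  -- Reflecting `η` turns the correlation into a convolution, at the price of near-evenness. With `ζ
  -- = ξ + η` the weight depends on `ζ` alone, and exchanging the integrals exposes `h*h(ζ)`.
  calc gaussForm h R = ∫⁻ ξ, ∫⁻ η, h ξ * h (-η) * E (ξ + η) := by
        refine lintegral_congr fun ξ => ?_
        rw [← lintegral_neg_eq_self]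
        simp only [hE, sub_neg_eq_add]
    _ ≤ ∫⁻ ξ, ∫⁻ η, K * (h ξ * h η * E (ξ + η)) := by
        refine lintegral_mono fun ξ => lintegral_mono_ae ?_
        filter_upwards [ae_ne_zero hn] with η hη
        calc _ ≤ h ξ * (K * h η) * E (ξ + η) :=
              mul_le_mul_left (mul_le_mul_right (hK η hη) _) _
          _ = _ := by ring
    _ = K * ∫⁻ ξ, ∫⁻ η, h ξ * h η * E (ξ + η) := by
        simp only [lintegral_const_mul' _ _ (ENNReal.coe_ne_top (r := K))]
    _ = K * ∫⁻ η, ∫⁻ ζ, h (ζ - η) * h η * E ζ := by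
        congr 1
        refine lintegral_congr fun ξ => ?_
        rw [← lintegral_sub_right_eq_self _ ξ]
        refine lintegral_congr fun ζ => ?_
        rw [add_sub_cancel, mul_comm (h ξ)]
    _ = K * ∫⁻ ζ, ∫⁻ η, h (ζ - η) * h η * E ζ := by rw [← lintegral_lintegral_swap hmeas]
    _ = K * ∫⁻ ζ, selfConv h ζ * E ζ := by
        simp only [lintegral_mul_const' _ _ (ENNReal.ofReal_ne_top), hE, selfConv]
    _ ≤ K * ∫⁻ ζ, B.toNNReal * (h ζ * E ζ) := by
        refine mul_le_mul_right (lintegral_mono_ae ?_) _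
        filter_upwards [hfin] with ζ hζ
        have := hconv ζ hζ
        rw [Real.rpow_zero, mul_one] at this
        rw [← mul_assoc]
        exact mul_le_mul_left this _
    _ = _ := by
        rw [lintegral_const_mul' _ _ ENNReal.coe_ne_top, ← mul_assoc]
        push_cast
        rfl

/-- Only the tail `|ζ|^{-n}` sees the logarithm; the integral of `h` over a ball is finite and is
absorbed since `1 + log₊(1/R) ≥ 1`. One logarithm in the quadratic form becomes a power `1/2` in the
norm. -/
lemma IsRadialMajorizingKernel.exists_gaussForm_le_log (hh : IsRadialMajorizingKernel 0 α n h)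
    (hn : 0 < n) :
    ∃ C : ℝ≥0, ∀ R : ℝ, 0 < R → gaussForm h R ≤ C * ENNReal.ofReal (1 + Real.posLog R⁻¹) := by
  obtain ⟨C₁, h₁⟩ := hh.exists_gaussForm_le_lintegral hn
  obtain ⟨C₂, ρ, hρ, h₂⟩ := hh.at_infinity.near_infinity
  obtain ⟨C₃, h₃⟩ := exists_lintegral_inv_pow_mul_gaussian_le hn
  have hI := hh.lintegral_ball_lt_top ρ
  refine ⟨C₁ * ((∫⁻ ξ in Metric.ball 0 ρ, h ξ).toNNReal + C₂ * C₃), fun R hR => ?_⟩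
  set E : Rn n → ℝ≥0∞ := fun ξ =>
    ENNReal.ofReal (Real.exp (-(R ^ 2 * ‖ξ‖ ^ 2 / (4 * Real.pi)))) with hE
  set Λ := ENNReal.ofReal (1 + Real.posLog R⁻¹) with hΛ
  have hΛ1 : 1 ≤ Λ := by
    rw [hΛ, ENNReal.one_le_ofReal]
    linarith [Real.posLog_nonneg (x := R⁻¹)]
  refine (h₁ R).trans ?_
  push_cast
  rw [ENNReal.coe_toNNReal hI.ne, mul_assoc]
  refine mul_le_mul_right ?_ _
  rw [← lintegral_add_compl _ (measurableSet_ball (x := (0 : Rn n)) (ε := ρ)), add_mul]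
  refine add_le_add ?_ ?_
  · calc _ ≤ ∫⁻ ξ in Metric.ball 0 ρ, h ξ :=
          lintegral_mono fun ξ => mul_le_of_le_one_right' (ofReal_exp_neg_le_one (by positivity))
      _ ≤ _ := le_mul_of_one_le_right zero_le hΛ1
  · calc _ ≤ ∫⁻ ξ in (Metric.ball (0 : Rn n) ρ)ᶜ, C₂ * (ENNReal.ofReal (‖ξ‖ ^ (-(n : ℝ))) * E ξ) := by
          refine setLIntegral_mono' measurableSet_ball.compl fun ξ hξ => ?_
          rw [← mul_assoc]
          exact mul_le_mul_left (h₂ ξ (by simpa using hξ)).1 _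
      _ ≤ ∫⁻ ξ in (Metric.ball (0 : Rn n) 1)ᶜ, C₂ * (ENNReal.ofReal (‖ξ‖ ^ (-(n : ℝ))) * E ξ) :=
          lintegral_mono_set (compl_subset_compl.mpr (Metric.ball_subset_ball hρ))
      _ = C₂ * ∫⁻ ξ in (Metric.ball (0 : Rn n) 1)ᶜ, ENNReal.ofReal (‖ξ‖ ^ (-(n : ℝ))) * E ξ :=
          lintegral_const_mul' _ _ ENNReal.coe_ne_top
      _ ≤ C₂ * (C₃ * Λ) := mul_le_mul_right (h₃ R hR) _
      _ = _ := by rw [mul_assoc]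

end Form

/-! ### The rate functions -/

/-- Needed because the supremum runs over all `R < √T`. By `log x ≤ x - 1`, passing from `S` to `R`
raises `log₊` by at most `S/R - 1`, which the factor `R²` absorbs. -/
lemma sq_mul_one_add_posLog_le {R S : ℝ} (hR : 0 < R) (hRS : R < S) :
    R ^ 2 * (1 + Real.posLog R⁻¹) ≤ S ^ 2 * (1 + Real.posLog S⁻¹) := by
  have hS : 0 < S := hR.trans hRS
  have hp : 0 ≤ Real.posLog S⁻¹ := Real.posLog_nonneg
  have hle : Real.posLog R⁻¹ ≤ Real.posLog S⁻¹ + (S / R - 1) := by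
    have h1 : (1 : ℝ) ≤ S / R := by rw [le_div_iff₀ hR]; linarith
    have h2 : Real.log R⁻¹ = Real.log S⁻¹ + Real.log (S / R) := by
      rw [← Real.log_mul (by positivity) (by positivity)]
      congr 1
      field_simp
    have h3 := Real.log_le_sub_one_of_pos (show 0 < S / R by positivity)
    have h4 : Real.log S⁻¹ ≤ Real.posLog S⁻¹ := le_max_right _ _
    rw [Real.posLog_apply]
    exact max_le (by linarith) (by linarith)
  calc R ^ 2 * (1 + Real.posLog R⁻¹) ≤ R ^ 2 * (Real.posLog S⁻¹ + S / R) := by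
        refine mul_le_mul_of_nonneg_left ?_ (sq_nonneg R)
        linarith
    _ = R ^ 2 * Real.posLog S⁻¹ + R * S := by field_simp
    _ ≤ S ^ 2 * Real.posLog S⁻¹ + S * S := by gcongr
    _ = _ := by ring

lemma rpow_half_mul_posLog_sq {T : ℝ} (hT : 0 < T) :
    (T ^ (1 / 2 : ℝ) * (1 + Real.posLog (T ^ (-1 / 2 : ℝ))) ^ (1 / 2 : ℝ)) ^ 2 =
      (√T) ^ 2 * (1 + Real.posLog (√T)⁻¹) := by
  have hp : 0 ≤ Real.posLog (T ^ (-1 / 2 : ℝ)) := Real.posLog_nonneg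
  rw [mul_pow, ← Real.sqrt_eq_rpow, ← Real.sqrt_eq_rpow,
    Real.sq_sqrt (x := 1 + Real.posLog _) (by positivity), neg_div, Real.rpow_neg hT.le,
    ← Real.sqrt_eq_rpow]

/-- Since `log₊ x ≤ x` for `x > 0`, the square of the rate is at most `T + √T`. -/
lemma tendsto_rpow_half_mul_posLog :
    Tendsto (fun T : ℝ => T ^ (1 / 2 : ℝ) * (1 + Real.posLog (T ^ (-1 / 2 : ℝ))) ^ (1 / 2 : ℝ))
      (𝓝[>] 0) (𝓝 0) := by
  have hlim : Tendsto (fun T : ℝ => √(T + √T)) (𝓝[>] 0) (𝓝 0) := by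
    have : Continuous fun T : ℝ => √(T + √T) := by fun_prop
    simpa using (this.tendsto 0).mono_left nhdsWithin_le_nhds
  refine tendsto_of_tendsto_of_tendsto_of_le_of_le' tendsto_const_nhds hlim ?_ ?_
  · filter_upwards [self_mem_nhdsWithin] with T (hT : 0 < T)
    have hp : 0 ≤ Real.posLog (T ^ (-1 / 2 : ℝ)) := Real.posLog_nonneg
    positivity
  · filter_upwards [self_mem_nhdsWithin] with T (hT : 0 < T)
    refine Real.le_sqrt_of_sq_le ?_
    have hS : 0 < √T := Real.sqrt_pos.mpr hT
    have h1 : Real.posLog (√T)⁻¹ ≤ (√T)⁻¹ := by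
      rw [Real.posLog_apply]
      exact max_le (by positivity)
        ((Real.log_le_sub_one_of_pos (by positivity)).trans (by linarith))
    rw [rpow_half_mul_posLog_sq hT]
    calc (√T) ^ 2 * (1 + Real.posLog (√T)⁻¹) ≤ (√T) ^ 2 * (1 + (√T)⁻¹) := by gcongr
      _ = (√T) ^ 2 + √T := by field_simp
      _ = T + √T := by rw [Real.sq_sqrt hT.le]

lemma tendsto_rpow_nhdsGT_zero {s : ℝ} (hs : 0 < s) :
    Tendsto (fun T : ℝ => T ^ s) (𝓝[>] 0) (𝓝 0) := by
  have := (Real.continuous_rpow_const hs.le).tendsto (0 : ℝ)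
  rw [Real.zero_rpow hs.ne'] at this
  exact this.mono_left nhdsWithin_le_nhds

/-! ### The `BMO⁻¹` bounds -/

section Bounds

variable {n : ℕ} {F : Type*} [NormedAddCommGroup F] [InnerProductSpace ℂ F] [CompleteSpace F]
  {θ α ω : ℝ} {h : Rn n → ℝ≥0∞}

lemma IsRadialMajorizingKernel.exists_bmoNorm_le (hh : IsRadialMajorizingKernel θ α ω h)
    {φ : ℝ → ℝ} (hφ : ∀ T, 0 < T → 0 < φ T) {D : ℝ≥0}
    (hD : ∀ T R, 0 < R → R ^ 2 < T →
      ENNReal.ofReal (R ^ 2) * gaussForm h R ≤ D * ENNReal.ofReal (φ T) ^ 2) :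
    ∃ C : ℝ≥0, ∀ f ∈ majSpace F h, ∀ T : ℝ, 0 < T →
      bmoNorm T f ≤ C * ENNReal.ofReal (φ T) * majNorm h f := by
  obtain ⟨K, hK⟩ := hh.exists_le_of_le_norm one_pos
  obtain ⟨C, hC⟩ := exists_bmoNorm_le_of_gaussForm_le (F := F) hh.pos hh.finite_ae hK hφ hD
  exact ⟨C, fun f _ T hT => hC f T hT⟩

theorem IsRadialMajorizingKernel.exists_bmoNorm_le_rpow (hh : IsRadialMajorizingKernel θ α ω h)
    (hn : 2 ≤ n) (hθ : 0 < θ) (hθ1 : θ < 1) :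
    ∃ C : ℝ≥0, ∀ f ∈ majSpace F h, ∀ T : ℝ, 0 < T →
      bmoNorm T f ≤ C * ENNReal.ofReal (T ^ ((1 - θ) / 2)) * majNorm h f := by
  obtain ⟨D, hD⟩ := hh.exists_gaussForm_le_rpow hn hθ hθ1
  refine hh.exists_bmoNorm_le (fun T hT => by positivity) (D := D) fun T R hR hRT => ?_
  calc _ ≤ ENNReal.ofReal (R ^ 2) * (D * ENNReal.ofReal (R ^ (-θ)) ^ 2) :=
        mul_le_mul_right (hD R hR) _
    _ = D * ENNReal.ofReal (R ^ (1 - θ)) ^ 2 := by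
        rw [sub_eq_add_neg, Real.rpow_add hR, Real.rpow_one, ENNReal.ofReal_mul hR.le,
          ENNReal.ofReal_pow hR.le]
        ring
    _ ≤ _ := by
        refine mul_le_mul_right (pow_le_pow_left' (ENNReal.ofReal_le_ofReal ?_) 2) _
        calc R ^ (1 - θ) = (R ^ 2) ^ ((1 - θ) / 2) := by
              rw [← Real.rpow_natCast, ← Real.rpow_mul hR.le]
              congr 1
              push_cast
              ring
          _ ≤ T ^ ((1 - θ) / 2) := by
              gcongr

theorem IsRadialMajorizingKernel.exists_bmoNorm_le_sqrt (hh : IsRadialMajorizingKernel θ α ω h)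
    (hω : n < ω) :
    ∃ C : ℝ≥0, ∀ f ∈ majSpace F h, ∀ T : ℝ, 0 < T →
      bmoNorm T f ≤ C * ENNReal.ofReal (T ^ (1 / 2 : ℝ)) * majNorm h f := by
  have hfin := hh.lintegral_lt_top hω
  refine hh.exists_bmoNorm_le (fun T hT => by positivity) (D := (∫⁻ ξ, h ξ).toNNReal ^ 2)
    fun T R hR hRT => ?_
  have hT : 0 ≤ T := (sq_nonneg R).trans hRT.le
  push_cast
  rw [ENNReal.coe_toNNReal hfin.ne, mul_comm, ← ENNReal.ofReal_pow (by positivity),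
    ← Real.sqrt_eq_rpow, Real.sq_sqrt hT]
  exact mul_le_mul' (gaussForm_le_sq_lintegral hh.aemeasurable R) (ENNReal.ofReal_le_ofReal hRT.le)

theorem IsRadialMajorizingKernel.exists_bmoNorm_le_log (hh : IsRadialMajorizingKernel 0 α n h)
    (hn : 0 < n) :
    ∃ C : ℝ≥0, ∀ f ∈ majSpace F h, ∀ T : ℝ, 0 < T →
      bmoNorm T f ≤ C * ENNReal.ofReal (T ^ (1 / 2 : ℝ) *
        (1 + Real.posLog (T ^ (-1 / 2 : ℝ))) ^ (1 / 2 : ℝ)) * majNorm h f := by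
  obtain ⟨D, hD⟩ := hh.exists_gaussForm_le_log hn
  refine hh.exists_bmoNorm_le (fun T hT => ?_) (D := D) fun T R hR hRT => ?_
  · have hp : 0 ≤ Real.posLog (T ^ (-1 / 2 : ℝ)) := Real.posLog_nonneg
    positivity
  have hT : 0 < T := (sq_pos_of_pos hR).trans hRT
  have hp : 0 ≤ Real.posLog (T ^ (-1 / 2 : ℝ)) := Real.posLog_nonneg
  rw [← ENNReal.ofReal_pow (by positivity), rpow_half_mul_posLog_sq hT]
  calc _ ≤ ENNReal.ofReal (R ^ 2) * (D * ENNReal.ofReal (1 + Real.posLog R⁻¹)) :=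
        mul_le_mul_right (hD R hR) _
    _ = D * ENNReal.ofReal (R ^ 2 * (1 + Real.posLog R⁻¹)) := by
        rw [ENNReal.ofReal_mul (by positivity)]
        ring
    _ ≤ _ := mul_le_mul_right (ENNReal.ofReal_le_ofReal
        (sq_mul_one_add_posLog_le hR (Real.lt_sqrt_of_sq_lt hRT))) _

end Bounds

end MajorizingKernels

end

/-! ### The theorem -/

theorem mainTheorem5 {n m : ℕ} (hn : 2 ≤ n) {θ α ω : ℝ} (h : Rn n → ℝ≥0∞)
    (hh : IsRadialMajorizingKernel θ α ω h) :
    (0 < θ → θ < 1 →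
      (∃ C : ℝ≥0, ∀ f ∈ majSpace (EuclideanSpace ℂ (Fin m)) h, ∀ T : ℝ, 0 < T →
        bmoNorm T f ≤ C * ENNReal.ofReal (T ^ ((1 - θ) / 2)) * majNorm h f) ∧
      ContinuouslyEmbeds (majSpace (EuclideanSpace ℂ (Fin m)) h) (majNorm h)
        (vmoSpace n (EuclideanSpace ℂ (Fin m))) (bmoNorm 1)) ∧
    (θ = 0 →
      (n < ω →
        ∃ C : ℝ≥0, ∀ f ∈ majSpace (EuclideanSpace ℂ (Fin m)) h, ∀ T : ℝ, 0 < T →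
          bmoNorm T f ≤ C * ENNReal.ofReal (T ^ (1 / 2 : ℝ)) * majNorm h f) ∧
      (ω = n →
        ∃ C : ℝ≥0, ∀ f ∈ majSpace (EuclideanSpace ℂ (Fin m)) h, ∀ T : ℝ, 0 < T →
          bmoNorm T f ≤ C * ENNReal.ofReal (T ^ (1 / 2 : ℝ) *
            (1 + Real.posLog (T ^ (-1 / 2 : ℝ))) ^ (1 / 2 : ℝ)) * majNorm h f) ∧
      ContinuouslyEmbeds (majSpace (EuclideanSpace ℂ (Fin m)) h) (majNorm h)
        (vmoSpace n (EuclideanSpace ℂ (Fin m))) (bmoNorm 1)) := by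
  have hn0 : 0 < n := by omega
  refine ⟨fun hθ hθ1 => ?_, ?_⟩
  · have hb := hh.exists_bmoNorm_le_rpow (F := EuclideanSpace ℂ (Fin m)) hn hθ hθ1
    exact ⟨hb, continuouslyEmbeds_vmoSpace (tendsto_rpow_nhdsGT_zero (by linarith)) hb⟩
  · rintro rfl
    have hgt : (n : ℝ) < ω → _ := hh.exists_bmoNorm_le_sqrt (F := EuclideanSpace ℂ (Fin m))
    have heq : ω = n → ∃ C : ℝ≥0, ∀ f ∈ majSpace (EuclideanSpace ℂ (Fin m)) h, ∀ T : ℝ, 0 < T →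
        bmoNorm T f ≤ C * ENNReal.ofReal (T ^ (1 / 2 : ℝ) *
          (1 + Real.posLog (T ^ (-1 / 2 : ℝ))) ^ (1 / 2 : ℝ)) * majNorm h f := by
      rintro rfl
      exact hh.exists_bmoNorm_le_log hn0
    refine ⟨hgt, heq, ?_⟩
    -- With `θ = 0` the kernel condition itself forces `ω ≥ n`, so one of the two rates always
    -- applies.
    rcases (show (n : ℝ) ≤ ω by simpa using hh.le_omega hn0).lt_or_eq with hlt | he
    · exact continuouslyEmbeds_vmoSpace (tendsto_rpow_nhdsGT_zero (by norm_num)) (hgt hlt)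
    · exact continuouslyEmbeds_vmoSpace tendsto_rpow_half_mul_posLog (heq he.symm)
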